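/- **Theorem (localization principle).** Let $n\ge 0$ be an integer and write $\langle\xi\rangle=(1+|\xi|^2)^{1/2}$ for $\xi\in\mathbb{R}^n$. Let $k:\mathbb{R}^n\to(0,\infty)$ be a weight function of polynomial growth, i.e. $k$ is measurable and there are constants $C,N>0$ with $$k(\xi+\eta)\le C\langle\xi\rangle^{N}k(\eta)\qquad(\xi,\eta\in\mathbb{R}^n).$$ Let $\mathcal{B}_k(\mathbb{R}^n)$ be the space of all $u\in\mathcal{S}'(\mathbb{R}^n)$ such that the Fourier transform $\widehat u$ (given by $\widehat\varphi(\xi)=\int e^{-i\langle x,\xi\rangle}\varphi(x)\,dx$ on Schwartz functions) is a function and $k\widehat u\in L^2(\mathbb{R}^n)$, with the norm $\|u\|_{\mathcal{B}_k}=\|k\widehat u\|_{L^2}$. For $\chi\in C_0^\infty(\mathbb{R}^n)$ and $y\in\mathbb{R}^n$ put $\tau_y\chi=\chi(\cdot-y)$. Let $\mathcal{B}_k^2(\mathbb{R}^n)$ be the space of all distributions $u\in\mathcal{D}'(\mathbb{R}^n)$ for which there is some $\chi\in C_0^\infty(\mathbb{R}^n)\setminus\{0\}$ such that $u\,\tau_y\chi\in\mathcal{B}_k(\mathbb{R}^n)$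 for all $y$ and the function $y\mapsto\|u\,\tau_y\chi\|_{\mathcal{B}_k}$ belongs to $L^2(\mathbb{R}^n)$; for $\chi\in C_0^\infty(\mathbb{R}^n)\setminus\{0\}$ put $$\|u\|_{k,2,\chi}=\Big(\int_{\mathbb{R}^n}\|u\,\tau_y\chi\|_{\mathcal{B}_k}^2\,dy\Big)^{1/2}.$$ Let $W(\mathcal{B}_k,L^2)$ be the Wiener amalgam space with local component $\mathcal{B}_k$, global component $L^2$ and window $\chi\in C_0^\infty(\mathbb{R}^n)\setminus\{0\}$, i.e. the space of all $u\in\mathcal{D}'(\mathbb{R}^n)$ such that $\varphi u\in\mathcal{B}_k(\mathbb{R}^n)$ for all $\varphi\in C_0^\infty(\mathbb{R}^n)$ and $y\mapsto\|u\,\tau_y\chi\|_{\mathcal{B}_k}$ belongs to $L^2(\mathbb{R}^n)$. Then, as subspaces of $\mathcal{D}'(\mathbb{R}^n)$, $$\mathcal{B}_k(\mathbb{R}^n)=\mathcal{B}_k^2(\mathbb{R}^n)=W(\mathcal{B}_k,L^2),$$ the last space being formed with any window $\chi\ne0$, and the norms are equivalent: for every $\chi\in C_0^\infty(\mathbb{R}^n)\setminus\{0\}$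 there is a constant $C>0$ such that $$\|u\|_{k,2,\chi}\le C\|u\|_{\mathcal{B}_k}\quad\text{and}\quad\|u\|_{\mathcal{B}_k}\le C\|u\|_{k,2,\chi}\qquad\text{for all }u\in\mathcal{B}_k(\mathbb{R}^n).$$ -/

import Mathlib

open MeasureTheory TopologicalSpace SchwartzMap
open scoped Distributions ENNReal NNReal ContDiff FourierTransform

noncomputable section

namespace Kato

/-- `ℝⁿ` with the Euclidean norm. -/
abbrev Rn (n : ℕ) : Type := EuclideanSpace ℝ (Fin n)

/-- `C₀^∞(ℝⁿ)`: complex-valued smooth functions with compact support. -/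
abbrev Test (n : ℕ) : Type := 𝓓((⊤ : Opens (Rn n)), ℂ)

/-- `𝓓'(ℝⁿ)`: continuous `ℂ`-linear functionals on `C₀^∞(ℝⁿ)` with its LF topology. -/
abbrev Distr (n : ℕ) : Type := Test n →L[ℂ] ℂ

/-- `𝓚_pol(ℝⁿ)`: weight functions of polynomial growth. -/
structure IsWeight {n : ℕ} (k : Rn n → ℝ) : Prop where
  measurable : Measurable k
  pos : ∀ ξ, 0 < k ξ
  growth : ∃ C N : ℝ, 0 < C ∧ 0 < N ∧
    ∀ ξ η : Rn n, k (ξ + η) ≤ C * (Real.sqrt (1 + ‖ξ‖ ^ 2)) ^ N * k η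

variable {n : ℕ}

/-! ### Inclusion of test functions in Schwartz functions, restriction of tempered distributions -/

/-- A test function, seen as a Schwartz function. -/
def Test.toSchwartz (φ : Test n) : 𝓢(Rn n, ℂ) :=
  φ.hasCompactSupport.toSchwartzMap φ.contDiff

@[simp] theorem Test.toSchwartz_apply (φ : Test n) (x : Rn n) : φ.toSchwartz x = φ x := rfl

/-- The inclusion `C₀^∞(ℝⁿ) ⊂ 𝓢(ℝⁿ)` as a continuous linear map. -/
def testToSchwartz (n : ℕ) : Test n →L[ℂ] 𝓢(Rn n, ℂ) :=
  TestFunction.mkCLM ℂ Test.toSchwartz (fun _ _ => by ext; rfl) (fun _ _ => by ext; rfl) <| by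
    intro K hK
    let L : 𝓓^{⊤}_{K}(Rn n, ℂ) →ₗ[ℂ] 𝓢(Rn n, ℂ) :=
      { toFun := Test.toSchwartz ∘ TestFunction.ofSupportedIn hK
        map_add' := fun _ _ => by ext; rfl
        map_smul' := fun _ _ => by ext; rfl }
    change Continuous L
    refine WithSeminorms.continuous_of_continuous_comp (schwartz_withSeminorms ℂ (Rn n) ℂ) L ?_
    rintro ⟨l, i⟩
    obtain ⟨R, hR⟩ := K.isCompact.isBounded.exists_norm_le
    let q := ContDiffMapSupportedIn.seminorm ℂ (Rn n) ℂ ⊤ K i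
    have hq : Continuous q :=
      (ContDiffMapSupportedIn.withSeminorms ℂ (Rn n) ℂ ⊤ K).continuous_seminorm i
    let c : ℝ≥0 := (max R 0).toNNReal ^ l
    have hcq : Continuous (c • q : Seminorm ℂ 𝓓^{⊤}_{K}(Rn n, ℂ)) := by
      change Continuous fun f => (c : ℝ) * q f
      fun_prop
    refine Seminorm.continuous_of_le hcq ?_
    intro f
    change SchwartzMap.seminorm ℂ l i (L f) ≤ (c : ℝ) * q f
    refine SchwartzMap.seminorm_le_bound ℂ l i _ (by positivity) ?_
    intro x
    change ‖x‖ ^ l * ‖iteratedFDeriv ℝ i f x‖ ≤ _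
    by_cases hx : x ∈ K
    · have h1 : ‖x‖ ≤ max R 0 := (hR x hx).trans (le_max_left _ _)
      have h2 : ‖iteratedFDeriv ℝ i f x‖ ≤ q f :=
        ContDiffMapSupportedIn.norm_iteratedFDeriv_apply_le_seminorm_top ℂ
      have hc : (c : ℝ) = (max R 0) ^ l := by simp [c]
      rw [hc]
      gcongr
    · rw [f.iteratedFDeriv_zero_on_compl hx]
      simp only [Pi.zero_apply, norm_zero, mul_zero]
      positivity

/-- The canonical map `𝓢'(ℝⁿ) → 𝓓'(ℝⁿ)`, restriction to test functions. -/
def restrict (T : 𝓢'(Rn n, ℂ)) : Distr n :=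
  (show 𝓢(Rn n, ℂ) →L[ℂ] ℂ from T) ∘L testToSchwartz n

theorem restrict_apply (T : 𝓢'(Rn n, ℂ)) (φ : Test n) : restrict T φ = T φ.toSchwartz := rfl

/-! ### Product of a distribution with a test function, as a tempered distribution -/

/-- Multiplication by the test function `χ`, as a map from `𝓢(ℝⁿ)` to smooth functions supported
in `supp χ`. -/
def mulSupportedIn (χ : Test n) :
    𝓢(Rn n, ℂ) →L[ℂ] 𝓓^{⊤}_{(⟨tsupport χ, χ.hasCompactSupport⟩ : Compacts (Rn n))}(Rn n, ℂ) where
  toFun φ := .of_support_subset (f := fun x => χ x * φ x) (χ.contDiff.mul (φ.smooth ⊤))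
    fun x hx => subset_closure (left_ne_zero_of_mul hx)
  map_add' φ ψ := by ext x; exact mul_add _ _ _
  map_smul' c φ := by ext x; exact mul_left_comm _ _ _
  cont := by
    let K : Compacts (Rn n) := ⟨tsupport χ, χ.hasCompactSupport⟩
    let L : 𝓢(Rn n, ℂ) →ₗ[ℂ] 𝓓^{⊤}_{K}(Rn n, ℂ) :=
      { toFun := fun φ => .of_support_subset (f := fun x => χ x * φ x)
          (χ.contDiff.mul (φ.smooth ⊤)) fun x hx => subset_closure (left_ne_zero_of_mul hx)
        map_add' := fun φ ψ => by ext x; exact mul_add _ _ _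
        map_smul' := fun c φ => by ext x; exact mul_left_comm _ _ _ }
    change Continuous L
    refine WithSeminorms.continuous_of_continuous_comp
      (ContDiffMapSupportedIn.withSeminorms ℂ (Rn n) ℂ ⊤ K) L ?_
    intro i
    let M : 𝓢(Rn n, ℂ) →L[ℂ] 𝓢(Rn n, ℂ) := SchwartzMap.smulLeftCLM ℂ χ.toSchwartz
    have hM : Continuous ((SchwartzMap.seminorm ℂ 0 i).comp
        (M : 𝓢(Rn n, ℂ) →ₗ[ℂ] 𝓢(Rn n, ℂ))) :=
      ((schwartz_withSeminorms ℂ (Rn n) ℂ).continuous_seminorm (0, i)).comp M.continuous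
    refine Seminorm.continuous_of_le hM ?_
    intro φ
    change ContDiffMapSupportedIn.seminorm ℂ (Rn n) ℂ ⊤ K i (L φ) ≤
      SchwartzMap.seminorm ℂ 0 i (M φ)
    rw [ContDiffMapSupportedIn.seminorm_top_le_iff ℂ (apply_nonneg _ _)]
    intro x _
    have hfun : (L φ : Rn n → ℂ) = M φ := by
      ext y
      simp only [M]
      rw [SchwartzMap.smulLeftCLM_apply_apply χ.toSchwartz.hasTemperateGrowth]
      rfl
    rw [hfun]
    exact SchwartzMap.norm_iteratedFDeriv_le_seminorm ℂ (M φ) i x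

/-- Multiplication by the test function `χ`, as a continuous linear map `𝓢(ℝⁿ) → C₀^∞(ℝⁿ)`. -/
def mulTest (χ : Test n) : 𝓢(Rn n, ℂ) →L[ℂ] Test n :=
  (TestFunction.ofSupportedInCLM ℂ (Set.subset_univ _)) ∘L mulSupportedIn χ

theorem mulTest_apply (χ : Test n) (φ : 𝓢(Rn n, ℂ)) (x : Rn n) :
    mulTest χ φ x = χ x * φ x := rfl

/-- The product `χ u` of `u ∈ 𝓓'(ℝⁿ)` and `χ ∈ C₀^∞(ℝⁿ)`. It has compact support, hence it is a
tempered distribution: `⟨χ u, φ⟩ = ⟨u, χ φ⟩` for all Schwartz functions `φ`. -/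
def smulDistr (χ : Test n) (u : Distr n) : 𝓢'(Rn n, ℂ) :=
  ContinuousLinearMap.toPointwiseConvergenceCLM _ _ _ _ (u ∘L mulTest χ)

theorem smulDistr_apply (χ : Test n) (u : Distr n) (φ : 𝓢(Rn n, ℂ)) :
    smulDistr χ u φ = u (mulTest χ φ) := rfl

/-- The translate `τ_y χ = χ(· - y)`. -/
def translate (y : Rn n) (χ : Test n) : Test n where
  toFun x := χ (x - y)
  contDiff' := χ.contDiff.comp (contDiff_id.sub contDiff_const)
  hasCompactSupport' := by
    simpa [Function.comp_def] using
      χ.hasCompactSupport.comp_homeomorph (Homeomorph.subRight y)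
  tsupport_subset' := Set.subset_univ _

theorem translate_apply (y : Rn n) (χ : Test n) (x : Rn n) : translate y χ x = χ (x - y) := rfl

/-! ### Fourier transform with the kernel `e^{-i⟨x, ξ⟩}` -/

/-- The dilation `ξ ↦ (2π)⁻¹ ξ` of `ℝⁿ`. -/
def dilation (n : ℕ) : Rn n ≃L[ℝ] Rn n :=
  ContinuousLinearEquiv.smulLeft (Units.mk0 ((2 * Real.pi)⁻¹ : ℝ) (by positivity))

/-- The Fourier transform `φ̂(ξ) = ∫ e^{-i⟨x, ξ⟩} φ(x) dx` on Schwartz functions (Mathlib's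
transform has the kernel `e^{-2πi⟨x, ξ⟩}`). -/
def hat (n : ℕ) : 𝓢(Rn n, ℂ) →L[ℂ] 𝓢(Rn n, ℂ) :=
  (SchwartzMap.compCLMOfContinuousLinearEquiv ℂ (dilation n)) ∘L
    (FourierTransform.fourierCLM ℂ 𝓢(Rn n, ℂ))

theorem hat_apply (φ : 𝓢(Rn n, ℂ)) (ξ : Rn n) :
    hat n φ ξ = ∫ x, Complex.exp (-Complex.I * (inner ℝ x ξ : ℝ)) * φ x := by
  change (𝓕 φ) ((2 * Real.pi)⁻¹ • ξ) = _
  rw [SchwartzMap.fourier_coe, Real.fourier_eq']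
  refine integral_congr_ae (.of_forall fun x => ?_)
  simp only [inner_smul_right, smul_eq_mul]
  congr 2
  have : (Real.pi : ℂ) ≠ 0 := by exact_mod_cast Real.pi_ne_zero
  push_cast
  field_simp

/-- The Fourier transform of a tempered distribution: `⟨T̂, φ⟩ = ⟨T, φ̂⟩`. -/
def hatDistr (T : 𝓢'(Rn n, ℂ)) : 𝓢'(Rn n, ℂ) :=
  PointwiseConvergenceCLM.precomp ℂ (hat n) T

theorem hatDistr_apply (T : 𝓢'(Rn n, ℂ)) (φ : 𝓢(Rn n, ℂ)) : hatDistr T φ = T (hat n φ) := rfl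

/-! ### The space `𝓑_k = B_{2,k}` -/

/-- The tempered distribution `T` is (given by) the function `f`: `⟨T, φ⟩ = ∫ φ f` with absolutely
convergent integrals. (If `k f ∈ L²` for a weight `k` of polynomial growth, the integrals converge
absolutely for every Schwartz function `φ`.) -/
def IsFunction (T : 𝓢'(Rn n, ℂ)) (f : Rn n → ℂ) : Prop :=
  LocallyIntegrable f ∧
    ∀ φ : 𝓢(Rn n, ℂ), Integrable (fun ξ => φ ξ * f ξ) ∧ T φ = ∫ ξ, φ ξ * f ξ

/-- `𝓑_k(ℝⁿ)`: tempered distributions `T` such that `T̂` is a function and `k T̂ ∈ L²`. -/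
def hormanderSpace (k : Rn n → ℝ) : Set 𝓢'(Rn n, ℂ) :=
  {T | ∃ f : Rn n → ℂ, IsFunction (hatDistr T) f ∧ MemLp (fun ξ => (k ξ : ℂ) * f ξ) 2 volume}

/-- The norm `‖T‖_{𝓑_k} = ‖k T̂‖_{L²}`, with the value `∞` outside `𝓑_k`. (The function `T̂` is
unique up to null sets, so the infimum runs over at most one value.) -/
def hormanderNorm (k : Rn n → ℝ) (T : 𝓢'(Rn n, ℂ)) : ℝ≥0∞ :=
  ⨅ (f : Rn n → ℂ) (_ : IsFunction (hatDistr T) f), eLpNorm (fun ξ => (k ξ : ℂ) * f ξ) 2 volume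

/-! ### The Kato-Sobolev type spaces `𝓑_k^p` and Wiener amalgam spaces -/

/-- The function `y ↦ ‖u τ_y χ‖_{𝓑_k}`. -/
def control (k : Rn n → ℝ) (χ : Test n) (u : Distr n) (y : Rn n) : ℝ≥0∞ :=
  hormanderNorm k (smulDistr (translate y χ) u)

/-- The norm `‖u‖_{k,p,χ}`, the `L^p` norm of `y ↦ ‖u τ_y χ‖_{𝓑_k}`. -/
def katoNorm (k : Rn n → ℝ) (p : ℝ≥0∞) (χ : Test n) (u : Distr n) : ℝ≥0∞ :=
  eLpNorm (control k χ u) p volume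

/-- `𝓑_k^p(ℝⁿ)`: distributions `u` such that for some test function `χ ≠ 0` all `u τ_y χ` are in
`𝓑_k` and `y ↦ ‖u τ_y χ‖_{𝓑_k}` is in `L^p`. -/
def katoSpace (k : Rn n → ℝ) (p : ℝ≥0∞) : Set (Distr n) :=
  {u | ∃ χ : Test n, χ ≠ 0 ∧ (∀ y, smulDistr (translate y χ) u ∈ hormanderSpace k) ∧
    MemLp (control k χ u) p volume}

/-- `𝓑_k^loc(ℝⁿ)`: distributions that are locally in `𝓑_k`. -/
def hormanderLoc (k : Rn n → ℝ) : Set (Distr n) :=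
  {u | ∀ φ : Test n, smulDistr φ u ∈ hormanderSpace k}

/-- The Wiener amalgam space `W(𝓑_k, L^p)` with local component `𝓑_k` and global component `L^p`,
formed with the window `χ`: all `u ∈ 𝓑_k^loc` whose control function `y ↦ ‖u τ_y χ‖_{𝓑_k}` is in
`L^p`. -/
def wienerAmalgam (k : Rn n → ℝ) (p : ℝ≥0∞) (χ : Test n) : Set (Distr n) :=
  {u | u ∈ hormanderLoc k ∧ MemLp (control k χ u) p volume}

end Kato

end

/-! Let `T ∈ 𝓑_k` have Fourier transform `f`. Up to a constant, the transform of `T τ_y χ` at `ξ` is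
`∫ e^{-i⟨y, ξ-η⟩} χ̂(ξ-η) f(η) dη`. For fixed `ξ` its modulus, as a function of `y`, is that of the
Fourier integral of `η ↦ χ̂(ξ-η) f(η)`. Plancherel in `y` and Tonelli therefore give an exact
identity (`IsWeight.katoNorm_sq_eq`): the squared amalgam norm is a constant times `∬ k(ξ)²
|χ̂(ξ-η)|² |f(η)|² dη dξ`. The growth condition compares `k(ξ)` with `k(η)` in both directions at
the cost of a power of `⟨ξ-η⟩`, which `χ̂` absorbs. This yields both norm inequalities on `𝓑_k`
(`IsWeight.exists_norm_equiv`).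

It remains to show that a distribution `u` with finite amalgam norm lies in `𝓑_k`. Since test
functions act boundedly on `𝓑_k`, dividing by a sum of `|τ_y χ|²` shows that `u` is locally in `𝓑_k`
(`IsWeight.mem_hormanderLoc`). The cutoffs `θ(·/R)`, `R ≥ 1`, have uniformly bounded multiplier
norms, so by the norm equivalence the `θ(·/R) u` are bounded in `𝓑_k`. Hence `|u(φ)|` is bounded by
the `L²` norm of `k⁻¹` times the inverse transform of `φ` (`IsWeight.exists_enorm_apply_le`), and
Hahn-Banach with the Riesz theorem produces the function that is the transform of `u`. -/

noncomputable section

namespace Kato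

variable {n : ℕ}

/-! ### Plancherel's theorem for functions in `L¹ ∩ L²` -/

/-- Plancherel's theorem for the Fourier integral of a function in `L¹ ∩ L²`. -/
theorem eLpNorm_fourier_eq {G : Rn n → ℂ} (h1 : Integrable G) (h2 : MemLp G 2) :
    eLpNorm (𝓕 G) 2 volume = eLpNorm G 2 volume := by
  set g : Lp ℂ 2 (volume : Measure (Rn n)) := h2.toLp G with hg
  have hcont : Continuous (𝓕 G) :=
    VectorFourier.fourierIntegral_continuous Real.continuous_fourierChar
      (by exact continuous_inner) h1
  -- The Fourier integral and the `L²` transform agree because against a test function both can be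
  -- moved onto the test function.
  have hae : 𝓕 G =ᵐ[volume] ((𝓕 g : Lp ℂ 2 (volume : Measure (Rn n))) : Rn n → ℂ) := by
    refine ae_eq_of_integral_contDiff_smul_eq hcont.locallyIntegrable
      ((Lp.memLp _).locallyIntegrable (by norm_num)) ?_
    intro φ hφ hφc
    have hφ₁ : HasCompactSupport (Complex.ofRealCLM ∘ φ) := hφc.comp_left rfl
    have hφ₂ : ContDiff ℝ ∞ (Complex.ofRealCLM ∘ φ) := by fun_prop
    set Φ : 𝓢(Rn n, ℂ) := hφ₁.toSchwartzMap hφ₂ with hΦ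
    have hΦa : ∀ x, Φ x = (φ x : ℂ) := fun x => rfl
    have e1 : ∫ x, φ x • 𝓕 G x = ∫ x, (𝓕 Φ) x • G x := by
      have := VectorFourier.integral_fourierIntegral_smul_eq_flip (L := innerₗ (Rn n))
        (μ := volume) (ν := volume) Real.continuous_fourierChar (by exact continuous_inner)
        Φ.integrable h1
      rw [flip_innerₗ] at this
      rw [SchwartzMap.fourier_coe]
      refine Eq.trans ?_ this.symm
      rfl
    have e2 : ∫ x, φ x • (𝓕 g : Lp ℂ 2 (volume : Measure (Rn n))) x = ∫ x, (𝓕 Φ) x • g x := by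
      have := congrArg (fun T : 𝓢'(Rn n, ℂ) => T Φ) (Lp.fourier_toTemperedDistribution_eq g)
      simp only [TemperedDistribution.fourier_apply, Lp.toTemperedDistribution_apply] at this
      rw [this]
      rfl
    rw [e1, e2]
    refine integral_congr_ae ?_
    filter_upwards [h2.coeFn_toLp] with x hx
    rw [hg, hx]
  rw [eLpNorm_congr_ae hae]
  have h3 := Lp.norm_fourier_eq g
  rw [Lp.norm_def, Lp.norm_def, ENNReal.toReal_eq_toReal_iff' (Lp.eLpNorm_ne_top _)
    (Lp.eLpNorm_ne_top _)] at h3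
  rw [h3, eLpNorm_congr_ae h2.coeFn_toLp]

theorem lintegral_enorm_sq_eq_eLpNorm_sq {α ε : Type*} [MeasurableSpace α] {μ : Measure α}
    [TopologicalSpace ε] [ContinuousENorm ε] (f : α → ε) :
    ∫⁻ x, ‖f x‖ₑ ^ 2 ∂μ = eLpNorm f 2 μ ^ 2 := by
  have := eLpNorm_nnreal_pow_eq_lintegral (μ := μ) (f := f) (p := 2) (by norm_num)
  simp only [ENNReal.coe_ofNat, NNReal.coe_ofNat] at this
  rw [← ENNReal.rpow_natCast, Nat.cast_ofNat, this]
  refine lintegral_congr fun x => ?_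
  rw [← ENNReal.rpow_natCast, Nat.cast_ofNat]

theorem lintegral_comp_smul (f : Rn n → ℝ≥0∞) {r : ℝ} (hr : r ≠ 0) :
    ∫⁻ x, f (r • x) = ENNReal.ofReal |(r ^ n)⁻¹| * ∫⁻ x, f x := by
  have h := (Homeomorph.smulOfNeZero r hr : Rn n ≃ₜ Rn n).measurableEmbedding.lintegral_map
    (μ := volume) f
  have h2 : Measure.map (Homeomorph.smulOfNeZero r hr : Rn n ≃ₜ Rn n) volume =
    ENNReal.ofReal |(r ^ n)⁻¹| • volume := by
    have := Measure.map_addHaar_smul (volume : Measure (Rn n)) hr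
    rw [finrank_euclideanSpace_fin] at this
    exact this
  rw [h2, lintegral_smul_measure] at h
  exact h.symm

/-- The constant in Plancherel's theorem for the kernel `e^{i⟨y, η⟩}`. -/
def plancherelConst (n : ℕ) : ℝ≥0∞ := ENNReal.ofReal |((-(2 * Real.pi)⁻¹) ^ n)⁻¹|

theorem plancherelConst_ne_zero (n : ℕ) : plancherelConst n ≠ 0 := by
  have : -(2 * Real.pi)⁻¹ ≠ 0 := by have := Real.pi_pos; simp [this.ne']
  simp only [plancherelConst, ne_eq, ENNReal.ofReal_eq_zero, not_le]
  positivity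

theorem plancherelConst_ne_top (n : ℕ) : plancherelConst n ≠ ⊤ := ENNReal.ofReal_ne_top

/-- The inner integral is `𝓕 G` at `-(2π)⁻¹ y`; the substitution produces the constant, which is
`(2π)ⁿ`. -/
theorem lintegral_enorm_sq_integral_exp {G : Rn n → ℂ} (h1 : Integrable G) (h2 : MemLp G 2) :
    ∫⁻ y, ‖∫ η, Complex.exp (Complex.I * (inner ℝ y η : ℝ)) * G η‖ₑ ^ 2 =
      plancherelConst n * ∫⁻ η, ‖G η‖ₑ ^ 2 := by
  have hr : -(2 * Real.pi)⁻¹ ≠ 0 := by have := Real.pi_pos; simp [this.ne']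
  rw [lintegral_enorm_sq_eq_eLpNorm_sq G, ← eLpNorm_fourier_eq h1 h2,
    ← lintegral_enorm_sq_eq_eLpNorm_sq, plancherelConst,
    ← lintegral_comp_smul (fun y => ‖𝓕 G y‖ₑ ^ 2) hr]
  refine lintegral_congr fun y => ?_
  congr 2
  rw [Real.fourier_eq']
  refine integral_congr_ae (.of_forall fun η => ?_)
  simp only [inner_smul_right, smul_eq_mul, real_inner_comm]
  congr 2
  have : (Real.pi : ℂ) ≠ 0 := by exact_mod_cast Real.pi_ne_zero
  push_cast
  field_simp

/-! ### Inversion of the Fourier transform -/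

/-- The inverse of the Fourier transform `hat` on Schwartz functions. -/
def hatInv (n : ℕ) : 𝓢(Rn n, ℂ) →L[ℂ] 𝓢(Rn n, ℂ) :=
  (FourierTransform.fourierInvCLM ℂ 𝓢(Rn n, ℂ)) ∘L
    (SchwartzMap.compCLMOfContinuousLinearEquiv ℂ (dilation n).symm)

theorem hatInv_hat (φ : 𝓢(Rn n, ℂ)) : hatInv n (hat n φ) = φ := by
  have : SchwartzMap.compCLMOfContinuousLinearEquiv ℂ (dilation n).symm (hat n φ) = 𝓕 φ := by
    ext x
    simp [hat]
  change 𝓕⁻ (SchwartzMap.compCLMOfContinuousLinearEquiv ℂ (dilation n).symm (hat n φ)) = φ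
  rw [this]
  exact FourierTransform.fourierInv_fourier_eq φ

theorem hat_hatInv (φ : 𝓢(Rn n, ℂ)) : hat n (hatInv n φ) = φ := by
  ext x
  change (𝓕 (𝓕⁻ (SchwartzMap.compCLMOfContinuousLinearEquiv ℂ (dilation n).symm φ)))
    (dilation n x) = φ x
  rw [FourierTransform.fourier_fourierInv_eq]
  simp

/-- The constant in the Fourier inversion formula. -/
def inversionConst (n : ℕ) : ℝ := |((2 * Real.pi) ^ n)⁻¹|

theorem inversionConst_pos (n : ℕ) : 0 < inversionConst n := by
  have := Real.pi_pos
  unfold inversionConst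
  positivity

theorem hatInv_apply (φ : 𝓢(Rn n, ℂ)) (η : Rn n) :
    hatInv n φ η =
      (inversionConst n : ℂ) * ∫ x, Complex.exp (Complex.I * (inner ℝ x η : ℝ)) * φ x := by
  have h := Measure.integral_comp_smul (volume : Measure (Rn n))
    (fun x => Complex.exp (Complex.I * (inner ℝ x η : ℝ)) * φ x) (2 * Real.pi)
  rw [finrank_euclideanSpace_fin] at h
  rw [inversionConst, ← Complex.real_smul, ← h]
  change (𝓕⁻ (SchwartzMap.compCLMOfContinuousLinearEquiv ℂ (dilation n).symm φ)) η = _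
  rw [SchwartzMap.fourierInv_coe, Real.fourierInv_eq']
  refine integral_congr_ae (.of_forall fun x => ?_)
  have hd : (dilation n).symm x = (2 * Real.pi) • x := by
    rw [ContinuousLinearEquiv.symm_apply_eq]
    change x = (2 * Real.pi)⁻¹ • ((2 * Real.pi) • x)
    rw [smul_smul, inv_mul_cancel₀ (by positivity), one_smul]
  simp only [SchwartzMap.compCLMOfContinuousLinearEquiv_apply, Function.comp, hd, smul_eq_mul,
    inner_smul_left]
  congr 2
  simp
  ring

/-- `∫ φ̂ g = ∫ φ ĝ`. -/
theorem integral_hat_mul (φ : 𝓢(Rn n, ℂ)) {g : Rn n → ℂ} (hg : Integrable g) :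
    ∫ x, hat n φ x * g x =
      ∫ ξ, φ ξ * ∫ x, Complex.exp (-Complex.I * (inner ℝ x ξ : ℝ)) * g x := by
  have hint : Integrable (Function.uncurry fun (x ξ : Rn n) =>
      Complex.exp (-Complex.I * (inner ℝ x ξ : ℝ)) * (g x * φ ξ)) (volume.prod volume) := by
    refine (hg.mul_prod φ.integrable).bdd_mul (c := 1) ?_ (.of_forall fun p => ?_)
    · exact Continuous.aestronglyMeasurable (by fun_prop)
    · rw [Complex.norm_exp]
      simp
  calc ∫ x, hat n φ x * g x
      = ∫ x, ∫ ξ, Complex.exp (-Complex.I * (inner ℝ x ξ : ℝ)) * (g x * φ ξ) := by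
        refine integral_congr_ae (.of_forall fun x => ?_)
        simp only [hat_apply]
        rw [← integral_mul_const]
        refine integral_congr_ae (.of_forall fun ξ => ?_)
        simp only [real_inner_comm]
        ring
    _ = ∫ ξ, ∫ x, Complex.exp (-Complex.I * (inner ℝ x ξ : ℝ)) * (g x * φ ξ) :=
        integral_integral_swap hint
    _ = _ := by
        refine integral_congr_ae (.of_forall fun ξ => ?_)
        simp only
        rw [← integral_const_mul]
        refine integral_congr_ae (.of_forall fun x => ?_)
        simp only
        ring

/-- Dual form of "product becomes convolution": the transform of `χ T` applied to `φ` is the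
transform of `T` applied to this function. -/
theorem hatInv_mul_hat (χ : Test n) (φ : 𝓢(Rn n, ℂ)) (η : Rn n) :
    hatInv n (mulTest χ (hat n φ)).toSchwartz η =
      (inversionConst n : ℂ) * ∫ ξ, φ ξ * hat n χ.toSchwartz (ξ - η) := by
  rw [hatInv_apply]
  have hg : Integrable fun x => Complex.exp (Complex.I * (inner ℝ x η : ℝ)) * χ x := by
    refine (χ.toSchwartz.integrable).bdd_mul (c := 1) ?_ (.of_forall fun p => ?_)
    · exact Continuous.aestronglyMeasurable (by fun_prop)
    · rw [Complex.norm_exp]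
      simp
  have := integral_hat_mul φ hg
  congr 1
  calc _ = ∫ x, hat n φ x * (Complex.exp (Complex.I * (inner ℝ x η : ℝ)) * χ x) := by
        refine integral_congr_ae (.of_forall fun x => ?_)
        simp only [Test.toSchwartz_apply, mulTest_apply]
        ring
    _ = _ := by
        rw [this]
        refine integral_congr_ae (.of_forall fun ξ => ?_)
        simp only [hat_apply]
        congr 1
        refine integral_congr_ae (.of_forall fun x => ?_)
        simp only [Test.toSchwartz_apply, inner_sub_right]
        rw [← mul_assoc, ← Complex.exp_add]
        congr 2
        push_cast
        ring

theorem hat_translate (y : Rn n) (χ : Test n) (ξ : Rn n) :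
    hat n (translate y χ).toSchwartz ξ =
      Complex.exp (-Complex.I * (inner ℝ y ξ : ℝ)) * hat n χ.toSchwartz ξ := by
  rw [hat_apply, hat_apply, ← integral_const_mul, ← integral_add_right_eq_self _ y]
  refine integral_congr_ae (.of_forall fun x => ?_)
  simp only [Test.toSchwartz_apply, translate_apply, add_sub_cancel_right, inner_add_left]
  rw [← mul_assoc, ← Complex.exp_add]
  congr 2
  push_cast
  ring

/-! ### Weights of polynomial growth -/

/-- The power `⟨ξ⟩ ^ N` of the Japanese bracket. -/
def bracket (N : ℝ) (ξ : Rn n) : ℝ := Real.sqrt (1 + ‖ξ‖ ^ 2) ^ N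

theorem bracket_eq (N : ℝ) (ξ : Rn n) : bracket N ξ = (1 + ‖ξ‖ ^ 2) ^ (N / 2) := by
  rw [bracket, Real.sqrt_eq_rpow, ← Real.rpow_mul (by positivity)]
  ring_nf

theorem bracket_pos (N : ℝ) (ξ : Rn n) : 0 < bracket N ξ := by
  rw [bracket_eq]
  positivity

theorem bracket_sub_comm (N : ℝ) (ξ η : Rn n) : bracket N (ξ - η) = bracket N (η - ξ) := by
  rw [bracket, bracket, norm_sub_rev]

theorem hasTemperateGrowth_bracket (N : ℝ) :
    (fun ξ : Rn n => (bracket N ξ : ℂ)).HasTemperateGrowth := by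
  simp only [bracket_eq]
  fun_prop

theorem continuous_bracket (N : ℝ) : Continuous (bracket N : Rn n → ℝ) := by
  have : (bracket N : Rn n → ℝ) = fun ξ => (1 + ‖ξ‖ ^ 2) ^ (N / 2) := funext (bracket_eq N)
  rw [this]
  exact (by fun_prop : Continuous fun ξ : Rn n => 1 + ‖ξ‖ ^ 2).rpow_const
    fun ξ => Or.inl (by positivity)

/-- Multiplication of Schwartz functions by `⟨ξ⟩ ^ N`. -/
def bracketMul (N : ℝ) : 𝓢(Rn n, ℂ) →L[ℂ] 𝓢(Rn n, ℂ) :=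
  SchwartzMap.smulLeftCLM ℂ fun ξ : Rn n => (bracket N ξ : ℂ)

theorem bracketMul_apply (N : ℝ) (φ : 𝓢(Rn n, ℂ)) (ξ : Rn n) :
    bracketMul N φ ξ = (bracket N ξ : ℂ) * φ ξ :=
  SchwartzMap.smulLeftCLM_apply_apply (hasTemperateGrowth_bracket N) φ ξ

/-- The bound `k(ξ) ≤ C ⟨ξ - η⟩ ^ N k(η)`. -/
def GrowthBound (k : Rn n → ℝ) (C N : ℝ) : Prop :=
  ∀ ξ η : Rn n, k ξ ≤ C * bracket N (ξ - η) * k η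

theorem IsWeight.exists_growthBound {k : Rn n → ℝ} (hk : IsWeight k) :
    ∃ C N : ℝ, 0 < C ∧ GrowthBound k C N := by
  obtain ⟨C, N, hC, -, h⟩ := hk.growth
  refine ⟨C, N, hC, fun ξ η => ?_⟩
  simpa [bracket] using h (ξ - η) η

variable {k : Rn n → ℝ} {C N : ℝ}

theorem IsWeight.measurable_ofReal (hk : IsWeight k) : Measurable fun ξ => (k ξ : ℂ) :=
  Complex.measurable_ofReal.comp hk.measurable

theorem IsWeight.ofReal_ne_zero (hk : IsWeight k) (ξ : Rn n) : (k ξ : ℂ) ≠ 0 :=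
  Complex.ofReal_ne_zero.2 (hk.pos ξ).ne'

theorem IsWeight.norm_ofReal (hk : IsWeight k) (ξ : Rn n) : ‖(k ξ : ℂ)‖ = k ξ := by
  rw [Complex.norm_real, Real.norm_of_nonneg (hk.pos ξ).le]

theorem norm_bracket (N : ℝ) (ξ : Rn n) : ‖(bracket N ξ : ℂ)‖ = bracket N ξ := by
  rw [Complex.norm_real, Real.norm_of_nonneg (bracket_pos N ξ).le]

theorem GrowthBound.enorm_le (hk : IsWeight k) (hC : 0 < C) (h : GrowthBound k C N) (ξ η : Rn n) :
    ‖(k ξ : ℂ)‖ₑ ≤ ENNReal.ofReal C * ‖(bracket N (ξ - η) : ℂ)‖ₑ * ‖(k η : ℂ)‖ₑ := by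
  rw [← ofReal_norm, ← ofReal_norm, ← ofReal_norm, hk.norm_ofReal, hk.norm_ofReal, norm_bracket,
    ← ENNReal.ofReal_mul hC.le, ← ENNReal.ofReal_mul (mul_pos hC (bracket_pos _ _)).le]
  exact ENNReal.ofReal_le_ofReal (h ξ η)

/-- Read as `1 / k(η) ≤ (C / k(ξ)) ⟨ξ-η⟩ ^ N`, the growth bound makes division by `k` cost only one
bracket factor, centred at any chosen `ξ`. -/
theorem GrowthBound.memLp_div (hk : IsWeight k) (h : GrowthBound k C N) (ξ : Rn n)
    {p : ℝ≥0∞} {ψ : Rn n → ℂ} (hψ : Measurable ψ)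
    (hψ' : MemLp (fun η => (bracket N (ξ - η) : ℂ) * ψ η) p) :
    MemLp (fun η => ψ η / (k η : ℂ)) p := by
  refine hψ'.of_le_mul (c := C / k ξ) (hψ.div hk.measurable_ofReal).aestronglyMeasurable
    (.of_forall fun η => ?_)
  rw [norm_div, norm_mul, hk.norm_ofReal, norm_bracket, div_mul_eq_mul_div, div_le_div_iff₀
    (hk.pos η) (hk.pos ξ)]
  nlinarith [mul_le_mul_of_nonneg_left (h ξ η) (norm_nonneg (ψ η))]

theorem IsWeight.memLp_schwartz_div (hk : IsWeight k) (φ : 𝓢(Rn n, ℂ)) (p : ℝ≥0∞) :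
    MemLp (fun η => φ η / (k η : ℂ)) p := by
  obtain ⟨C, N, -, h⟩ := hk.exists_growthBound
  refine h.memLp_div hk 0 φ.continuous.measurable ?_
  refine ((bracketMul N φ).memLp p volume).ae_eq (.of_forall fun η => ?_)
  simp only [bracketMul_apply, bracket_sub_comm N 0 η, sub_zero]

theorem IsWeight.memLp_schwartz_sub_div (hk : IsWeight k) (φ : 𝓢(Rn n, ℂ)) (p : ℝ≥0∞) (ξ : Rn n) :
    MemLp (fun η => φ (ξ - η) / (k η : ℂ)) p := by
  obtain ⟨C, N, -, h⟩ := hk.exists_growthBound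
  refine h.memLp_div hk ξ (φ.continuous.comp (by fun_prop)).measurable ?_
  refine (((bracketMul N φ).memLp p volume).comp_measurePreserving
    (Measure.measurePreserving_sub_left volume ξ)).ae_eq (.of_forall fun η => ?_)
  simp only [Function.comp, bracketMul_apply]

/-- Factor the product as `(φ(ξ-·) / k) · (k f)`, with the first factor in `L^∞` here and in `L²` in
the next lemma. Together they put it in `L¹ ∩ L²` for every `ξ`, as Plancherel in `y` requires. -/
theorem IsWeight.memLp_sub_mul (hk : IsWeight k) (φ : 𝓢(Rn n, ℂ)) {f : Rn n → ℂ}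
    (hf : MemLp (fun ξ => (k ξ : ℂ) * f ξ) 2) (ξ : Rn n) : MemLp (fun η => φ (ξ - η) * f η) 2 := by
  refine (hf.mul (hk.memLp_schwartz_sub_div φ ⊤ ξ) (r := 2)).ae_eq (.of_forall fun η => ?_)
  simp only [Pi.mul_apply]
  rw [← mul_assoc, div_mul_cancel₀ _ (hk.ofReal_ne_zero η)]

theorem IsWeight.integrable_sub_mul (hk : IsWeight k) (φ : 𝓢(Rn n, ℂ)) {f : Rn n → ℂ}
    (hf : MemLp (fun ξ => (k ξ : ℂ) * f ξ) 2) (ξ : Rn n) :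
    Integrable (fun η => φ (ξ - η) * f η) := by
  refine ((hk.memLp_schwartz_sub_div φ 2 ξ).integrable_mul hf).congr (.of_forall fun η => ?_)
  simp only [Pi.mul_apply]
  rw [← mul_assoc, div_mul_cancel₀ _ (hk.ofReal_ne_zero η)]

theorem IsWeight.integrable_mul (hk : IsWeight k) (φ : 𝓢(Rn n, ℂ)) {f : Rn n → ℂ}
    (hf : MemLp (fun ξ => (k ξ : ℂ) * f ξ) 2) : Integrable (fun η => φ η * f η) := by
  refine ((hk.memLp_schwartz_div φ 2).integrable_mul hf).congr (.of_forall fun η => ?_)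
  simp only [Pi.mul_apply]
  rw [← mul_assoc, div_mul_cancel₀ _ (hk.ofReal_ne_zero η)]

theorem IsWeight.aestronglyMeasurable (hk : IsWeight k) {f : Rn n → ℂ}
    (hf : MemLp (fun ξ => (k ξ : ℂ) * f ξ) 2) : AEStronglyMeasurable f := by
  have := (hf.aestronglyMeasurable.aemeasurable.div hk.measurable_ofReal.aemeasurable)
  refine this.aestronglyMeasurable.congr (.of_forall fun η => ?_)
  simp only [Pi.div_apply]
  rw [mul_div_cancel_left₀ _ (hk.ofReal_ne_zero η)]

/-- So `f` is an `L²` function times a smooth function of polynomial growth; this makes it locally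
integrable and a tempered distribution. -/
theorem GrowthBound.memLp_div_bracket (hk : IsWeight k) (h : GrowthBound k C N) {f : Rn n → ℂ}
    (hf : MemLp (fun ξ => (k ξ : ℂ) * f ξ) 2) : MemLp (fun ξ => f ξ / (bracket N ξ : ℂ)) 2 := by
  refine hf.of_le_mul (c := C / k 0) ?_ (.of_forall fun η => ?_)
  · exact ((hk.aestronglyMeasurable hf).aemeasurable.div (Complex.measurable_ofReal.comp
      (continuous_bracket N).measurable).aemeasurable).aestronglyMeasurable
  have := h 0 η
  rw [bracket_sub_comm, sub_zero] at this
  rw [norm_div, norm_mul, hk.norm_ofReal, norm_bracket, div_mul_eq_mul_div, div_le_div_iff₀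
    (bracket_pos N η) (hk.pos 0)]
  nlinarith [mul_le_mul_of_nonneg_left this (norm_nonneg (f η))]

theorem IsWeight.locallyIntegrable (hk : IsWeight k) {f : Rn n → ℂ}
    (hf : MemLp (fun ξ => (k ξ : ℂ) * f ξ) 2) : LocallyIntegrable f := by
  obtain ⟨C, N, -, h⟩ := hk.exists_growthBound
  have h1 := (h.memLp_div_bracket hk hf).locallyIntegrable (by norm_num)
  have hb : Continuous fun ξ : Rn n => (bracket N ξ : ℂ) :=
    Complex.continuous_ofReal.comp (continuous_bracket N)
  have h2 : LocallyIntegrable fun ξ => (bracket N ξ : ℂ) * (f ξ / (bracket N ξ : ℂ)) := by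
    rw [locallyIntegrable_iff] at h1 ⊢
    intro K hK
    exact (h1 K hK).continuousOn_mul hb.continuousOn hK
  convert h2 using 2 with ξ
  rw [mul_div_cancel₀]
  exact Complex.ofReal_ne_zero.2 (bracket_pos N ξ).ne'

/-! ### Functions representing tempered distributions -/

theorem IsFunction.ae_eq {T : 𝓢'(Rn n, ℂ)} {f g : Rn n → ℂ} (hf : IsFunction T f)
    (hg : IsFunction T g) : f =ᵐ[volume] g := by
  refine ae_eq_of_integral_contDiff_smul_eq hf.1 hg.1 fun φ hφ hφc => ?_
  have hφ₁ : HasCompactSupport (Complex.ofRealCLM ∘ φ) := hφc.comp_left rfl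
  have hφ₂ : ContDiff ℝ ∞ (Complex.ofRealCLM ∘ φ) := by fun_prop
  exact ((hf.2 (hφ₁.toSchwartzMap hφ₂)).2.symm.trans (hg.2 (hφ₁.toSchwartzMap hφ₂)).2)

theorem IsFunction.congr {T : 𝓢'(Rn n, ℂ)} {f g : Rn n → ℂ} (hf : IsFunction T f)
    (h : f =ᵐ[volume] g) : IsFunction T g := by
  have h' : ∀ φ : 𝓢(Rn n, ℂ), (fun ξ => φ ξ * f ξ) =ᵐ[volume] fun ξ => φ ξ * g ξ := fun φ => by
    filter_upwards [h] with ξ hξ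
    rw [hξ]
  exact ⟨hf.1.congr h, fun φ => ⟨(hf.2 φ).1.congr (h' φ),
    (hf.2 φ).2.trans (integral_congr_ae (h' φ))⟩⟩

theorem IsWeight.isFunction (hk : IsWeight k) {T : 𝓢'(Rn n, ℂ)} {f : Rn n → ℂ}
    (hf : MemLp (fun ξ => (k ξ : ℂ) * f ξ) 2) (h : ∀ φ : 𝓢(Rn n, ℂ), T φ = ∫ ξ, φ ξ * f ξ) :
    IsFunction T f :=
  ⟨hk.locallyIntegrable hf, fun φ => ⟨hk.integrable_mul φ hf, h φ⟩⟩

theorem hormanderNorm_eq {T : 𝓢'(Rn n, ℂ)} {f : Rn n → ℂ} (hf : IsFunction (hatDistr T) f) :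
    hormanderNorm k T = eLpNorm (fun ξ => (k ξ : ℂ) * f ξ) 2 volume := by
  refine le_antisymm (iInf₂_le f hf) (le_iInf₂ fun g hg => ?_)
  refine (eLpNorm_congr_ae ?_).le
  filter_upwards [hf.ae_eq hg] with ξ hξ
  rw [hξ]

theorem exists_measurable_of_mem_hormanderSpace {T : 𝓢'(Rn n, ℂ)} (hT : T ∈ hormanderSpace k) :
    ∃ f : Rn n → ℂ, Measurable f ∧ IsFunction (hatDistr T) f ∧
      MemLp (fun ξ => (k ξ : ℂ) * f ξ) 2 volume := by
  obtain ⟨f, hf, hkf⟩ := hT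
  have hm := hf.1.aestronglyMeasurable
  refine ⟨hm.mk f, hm.stronglyMeasurable_mk.measurable, hf.congr hm.ae_eq_mk, hkf.ae_eq ?_⟩
  filter_upwards [hm.ae_eq_mk] with ξ hξ
  rw [← hξ]

/-! ### Inequalities for lower integrals -/

theorem sq_lintegral_mul_le {α : Type*} [MeasurableSpace α] (μ : Measure α) {f g : α → ℝ≥0∞}
    (hf : AEMeasurable f μ) (hg : AEMeasurable g μ) :
    (∫⁻ x, f x * g x ∂μ) ^ 2 ≤ (∫⁻ x, f x ^ 2 ∂μ) * ∫⁻ x, g x ^ 2 ∂μ := by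
  have h := ENNReal.lintegral_mul_le_Lp_mul_Lq μ (p := 2) (q := 2)
    (Real.holderConjugate_iff.2 ⟨by norm_num, by norm_num⟩) hf hg
  have h' := pow_le_pow_left' h 2
  simp only [Pi.mul_apply, mul_pow] at h'
  have e : ∀ a : ℝ≥0∞, (a ^ (1 / 2 : ℝ)) ^ 2 = a := fun a => by
    rw [← ENNReal.rpow_natCast, ← ENNReal.rpow_mul]
    norm_num
  rw [e, e] at h'
  simpa only [ENNReal.rpow_two] using h'

/-- Cauchy-Schwarz for the measure `a dμ`, via the splitting `a b = a^{1/2} · (a^{1/2} b)`. -/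
theorem sq_lintegral_mul_le_lintegral_mul {α : Type*} [MeasurableSpace α] (μ : Measure α)
    {a b : α → ℝ≥0∞} (ha : Measurable a) (hb : Measurable b) :
    (∫⁻ x, a x * b x ∂μ) ^ 2 ≤ (∫⁻ x, a x ∂μ) * ∫⁻ x, a x * b x ^ 2 ∂μ := by
  have hs : ∀ t : ℝ≥0∞, t ^ (1 / 2 : ℝ) * t ^ (1 / 2 : ℝ) = t := fun t => by
    rw [← ENNReal.rpow_add_of_nonneg _ _ (by norm_num) (by norm_num)]
    norm_num
  have h := sq_lintegral_mul_le μ (f := fun x => a x ^ (1 / 2 : ℝ))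
    (g := fun x => a x ^ (1 / 2 : ℝ) * b x) (by fun_prop) (by fun_prop)
  simpa only [← mul_assoc, mul_pow, sq (_ ^ (1 / 2 : ℝ)), hs] using h

/-- Young's inequality `‖a * b‖₂ ≤ ‖a‖₁ ‖b‖₂`. -/
theorem lintegral_sq_convolution_le {a b : Rn n → ℝ≥0∞} (ha : Measurable a) (hb : Measurable b) :
    ∫⁻ ξ, (∫⁻ η, a (ξ - η) * b η) ^ 2 ≤ (∫⁻ ζ, a ζ) ^ 2 * ∫⁻ η, b η ^ 2 := by
  calc ∫⁻ ξ, (∫⁻ η, a (ξ - η) * b η) ^ 2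
      ≤ ∫⁻ ξ, (∫⁻ ζ, a ζ) * ∫⁻ η, a (ξ - η) * b η ^ 2 := by
        refine lintegral_mono fun ξ => ?_
        refine (sq_lintegral_mul_le_lintegral_mul volume (a := fun η => a (ξ - η)) (b := b)
          (by fun_prop) hb).trans_eq ?_
        rw [lintegral_sub_left_eq_self]
    _ = (∫⁻ ζ, a ζ) * ∫⁻ ξ, ∫⁻ η, a (ξ - η) * b η ^ 2 :=
        lintegral_const_mul _ (Measurable.lintegral_prod_right (by fun_prop))
    _ = (∫⁻ ζ, a ζ) * ∫⁻ η, ∫⁻ ξ, a (ξ - η) * b η ^ 2 := by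
        rw [lintegral_lintegral_swap]
        fun_prop
    _ = (∫⁻ ζ, a ζ) * ∫⁻ η, (∫⁻ ζ, a ζ) * b η ^ 2 := by
        congr 1
        refine lintegral_congr fun η => ?_
        rw [lintegral_mul_const _ (by fun_prop), lintegral_sub_right_eq_self]
    _ = _ := by
        rw [lintegral_const_mul _ (by fun_prop), ← mul_assoc, sq]

/-! ### The Fourier transform of a product -/

/-- Pulling `k(ξ)` inside and trading it for `C ⟨ξ-η⟩ ^ N k(η)` leaves an unweighted convolution
with `k f`, to which Young's inequality applies. -/
theorem GrowthBound.lintegral_sq_convolution_le (hk : IsWeight k) (hC : 0 < C)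
    (h : GrowthBound k C N) (φ : 𝓢(Rn n, ℂ)) {f : Rn n → ℂ} (hf : Measurable f) :
    ∫⁻ ξ, (‖(k ξ : ℂ)‖ₑ * ∫⁻ η, ‖φ (ξ - η)‖ₑ * ‖f η‖ₑ) ^ 2 ≤
      (ENNReal.ofReal C * ∫⁻ ζ, ‖bracketMul N φ ζ‖ₑ) ^ 2 * ∫⁻ η, ‖(k η : ℂ) * f η‖ₑ ^ 2 := by
  have hφ := φ.continuous.measurable
  have hφN := (bracketMul N φ).continuous.measurable
  have hkm := hk.measurable_ofReal
  calc _ ≤ ∫⁻ ξ, (∫⁻ η, (ENNReal.ofReal C * ‖bracketMul N φ (ξ - η)‖ₑ) *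
            ‖(k η : ℂ) * f η‖ₑ) ^ 2 := by
        refine lintegral_mono fun ξ => pow_le_pow_left' ?_ 2
        rw [← lintegral_const_mul _ (by fun_prop)]
        refine lintegral_mono fun η => ?_
        rw [bracketMul_apply, enorm_mul, enorm_mul]
        calc _ ≤ (ENNReal.ofReal C * ‖(bracket N (ξ - η) : ℂ)‖ₑ * ‖(k η : ℂ)‖ₑ) *
              (‖φ (ξ - η)‖ₑ * ‖f η‖ₑ) := by gcongr; exact h.enorm_le hk hC ξ η
          _ = _ := by ring
    _ ≤ _ := by
        refine (Kato.lintegral_sq_convolution_le (a := fun ζ =>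
          ENNReal.ofReal C * ‖bracketMul N φ ζ‖ₑ) (b := fun η => ‖(k η : ℂ) * f η‖ₑ)
          (by fun_prop) (by fun_prop)).trans_eq ?_
        rw [lintegral_const_mul _ (by fun_prop)]

/-- The Fourier transform of `χ T`, where `f` is the Fourier transform of `T`. -/
def prodHat (χ : Test n) (f : Rn n → ℂ) (ξ : Rn n) : ℂ :=
  (inversionConst n : ℂ) * ∫ η, hat n χ.toSchwartz (ξ - η) * f η

/-- The norm of multiplication by `χ` on `𝓑_k` is at most this constant. -/
def multiplierConst (C N : ℝ) (χ : Test n) : ℝ≥0∞ :=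
  ‖(inversionConst n : ℂ)‖ₑ * (ENNReal.ofReal C * ∫⁻ ζ, ‖bracketMul N (hat n χ.toSchwartz) ζ‖ₑ)

theorem multiplierConst_lt_top (C N : ℝ) (χ : Test n) : multiplierConst C N χ < ⊤ := by
  have := (bracketMul N (hat n χ.toSchwartz)).integrable (μ := volume)
  exact ENNReal.mul_lt_top enorm_lt_top (ENNReal.mul_lt_top ENNReal.ofReal_lt_top this.2)

theorem measurable_prodHat (χ : Test n) {f : Rn n → ℂ} (hf : Measurable f) :
    Measurable (prodHat χ f) := by
  have hφ := (hat n χ.toSchwartz).continuous.measurable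
  have : Measurable (Function.uncurry fun ξ η : Rn n => hat n χ.toSchwartz (ξ - η) * f η) := by
    unfold Function.uncurry
    fun_prop
  exact (this.stronglyMeasurable.integral_prod_right).measurable.const_mul _

theorem GrowthBound.eLpNorm_prodHat_le (hk : IsWeight k) (hC : 0 < C) (h : GrowthBound k C N)
    (χ : Test n) {f : Rn n → ℂ} (hf : Measurable f) :
    eLpNorm (fun ξ => (k ξ : ℂ) * prodHat χ f ξ) 2 volume ≤
      multiplierConst C N χ * eLpNorm (fun ξ => (k ξ : ℂ) * f ξ) 2 volume := by
  have hφ := (hat n χ.toSchwartz).continuous.measurable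
  have hkm := hk.measurable_ofReal
  rw [← ENNReal.pow_le_pow_left_iff (n := 2) two_ne_zero, mul_pow,
    ← lintegral_enorm_sq_eq_eLpNorm_sq, ← lintegral_enorm_sq_eq_eLpNorm_sq, multiplierConst,
    mul_pow, mul_assoc]
  have hm : Measurable fun ξ => (‖(k ξ : ℂ)‖ₑ *
      ∫⁻ η, ‖hat n χ.toSchwartz (ξ - η)‖ₑ * ‖f η‖ₑ) ^ 2 := by
    refine Measurable.pow_const (Measurable.mul (by fun_prop) ?_) 2
    exact Measurable.lintegral_prod_right
      (f := fun ξ η => ‖hat n χ.toSchwartz (ξ - η)‖ₑ * ‖f η‖ₑ) (by unfold Function.uncurry; fun_prop)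
  calc _ ≤ ∫⁻ ξ, ‖(inversionConst n : ℂ)‖ₑ ^ 2 * (‖(k ξ : ℂ)‖ₑ *
            ∫⁻ η, ‖hat n χ.toSchwartz (ξ - η)‖ₑ * ‖f η‖ₑ) ^ 2 := by
        refine lintegral_mono fun ξ => ?_
        rw [prodHat, ← mul_pow]
        refine pow_le_pow_left' ?_ 2
        rw [enorm_mul, enorm_mul, mul_left_comm]
        gcongr
        refine (enorm_integral_le_lintegral_enorm _).trans_eq ?_
        simp only [enorm_mul]
    _ ≤ _ := by
        rw [lintegral_const_mul _ hm]
        gcongr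
        exact h.lintegral_sq_convolution_le hk hC _ hf

theorem IsWeight.memLp_prodHat (hk : IsWeight k) (χ : Test n) {f : Rn n → ℂ} (hf : Measurable f)
    (hkf : MemLp (fun ξ => (k ξ : ℂ) * f ξ) 2) : MemLp (fun ξ => (k ξ : ℂ) * prodHat χ f ξ) 2 := by
  obtain ⟨C, N, hC, h⟩ := hk.exists_growthBound
  exact ⟨(hk.measurable_ofReal.mul (measurable_prodHat χ hf)).aestronglyMeasurable,
    (h.eLpNorm_prodHat_le hk hC χ hf).trans_lt
      (ENNReal.mul_lt_top (multiplierConst_lt_top C N χ) hkf.2)⟩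

/-- Justifies Fubini for the transform of a product: write `φ = (φ / k) · k` and apply
Cauchy-Schwarz in `ξ`, the weighted convolution being in `L²`. -/
theorem IsWeight.integrable_prod (hk : IsWeight k) (φ ψ : 𝓢(Rn n, ℂ)) {f : Rn n → ℂ}
    (hf : Measurable f) (hkf : MemLp (fun ξ => (k ξ : ℂ) * f ξ) 2) :
    Integrable (Function.uncurry fun ξ η : Rn n => φ ξ * (ψ (ξ - η) * f η))
      (volume.prod volume) := by
  obtain ⟨C, N, hC, h⟩ := hk.exists_growthBound
  have hφ := φ.continuous.measurable
  have hψ := ψ.continuous.measurable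
  have hkm := hk.measurable_ofReal
  have hm : Measurable (Function.uncurry fun ξ η : Rn n => φ ξ * (ψ (ξ - η) * f η)) := by
    unfold Function.uncurry
    fun_prop
  refine ⟨hm.aestronglyMeasurable, ?_⟩
  rw [hasFiniteIntegral_iff_enorm, lintegral_prod _ hm.enorm.aemeasurable]
  have hH : Measurable fun ξ => ∫⁻ η, ‖ψ (ξ - η)‖ₑ * ‖f η‖ₑ :=
    Measurable.lintegral_prod_right (f := fun ξ η => ‖ψ (ξ - η)‖ₑ * ‖f η‖ₑ)
      (by unfold Function.uncurry; fun_prop)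
  have e : ∫⁻ ξ, ∫⁻ η, ‖Function.uncurry (fun ξ η : Rn n => φ ξ * (ψ (ξ - η) * f η)) (ξ, η)‖ₑ =
      ∫⁻ ξ, ‖φ ξ / (k ξ : ℂ)‖ₑ * (‖(k ξ : ℂ)‖ₑ * ∫⁻ η, ‖ψ (ξ - η)‖ₑ * ‖f η‖ₑ) := by
    refine lintegral_congr fun ξ => ?_
    simp only [Function.uncurry_apply_pair, enorm_mul]
    rw [lintegral_const_mul _ (by fun_prop), ← mul_assoc, ← enorm_mul,
      div_mul_cancel₀ _ (hk.ofReal_ne_zero ξ)]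
  rw [e]
  refine ((ENNReal.pow_lt_top_iff (n := 2)).1 ?_).resolve_right two_ne_zero
  refine (sq_lintegral_mul_le volume (by fun_prop) (by fun_prop)).trans_lt ?_
  refine ENNReal.mul_lt_top ?_ ?_
  · rw [lintegral_enorm_sq_eq_eLpNorm_sq]
    exact ENNReal.pow_lt_top (hk.memLp_schwartz_div φ 2).2
  · refine (h.lintegral_sq_convolution_le hk hC ψ hf).trans_lt (ENNReal.mul_lt_top ?_ ?_)
    · exact ENNReal.pow_lt_top (ENNReal.mul_lt_top ENNReal.ofReal_lt_top
        ((bracketMul N ψ).integrable (μ := volume)).2)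
    · rw [lintegral_enorm_sq_eq_eLpNorm_sq]
      exact ENNReal.pow_lt_top hkf.2

theorem IsWeight.isFunction_prodHat (hk : IsWeight k) (χ : Test n) {T : 𝓢'(Rn n, ℂ)}
    {f : Rn n → ℂ} (hf : Measurable f) (hkf : MemLp (fun ξ => (k ξ : ℂ) * f ξ) 2)
    (hT : IsFunction (hatDistr T) f) :
    IsFunction (hatDistr (smulDistr χ (restrict T))) (prodHat χ f) := by
  refine hk.isFunction (hk.memLp_prodHat χ hf hkf) fun φ => ?_
  have e : hatDistr (smulDistr χ (restrict T)) φ =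
      hatDistr T (hatInv n (mulTest χ (hat n φ)).toSchwartz) := by
    rw [hatDistr_apply, hatDistr_apply, hat_hatInv]
    rfl
  have hint := hk.integrable_prod φ (hat n χ.toSchwartz) hf hkf
  rw [e, (hT.2 _).2]
  calc _ = ∫ η, ∫ ξ, (inversionConst n : ℂ) * (φ ξ * (hat n χ.toSchwartz (ξ - η) * f η)) := by
        refine integral_congr_ae (.of_forall fun η => ?_)
        simp only [hatInv_mul_hat]
        rw [integral_const_mul, mul_assoc, ← integral_mul_const]
        simp only [mul_assoc]
    _ = ∫ ξ, ∫ η, (inversionConst n : ℂ) * (φ ξ * (hat n χ.toSchwartz (ξ - η) * f η)) :=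
        (integral_integral_swap (hint.const_mul _)).symm
    _ = _ := by
        refine integral_congr_ae (.of_forall fun ξ => ?_)
        simp only [prodHat]
        rw [integral_const_mul, integral_const_mul, mul_left_comm]

theorem IsWeight.smulDistr_mem (hk : IsWeight k) (χ : Test n) {T : 𝓢'(Rn n, ℂ)}
    (hT : T ∈ hormanderSpace k) : smulDistr χ (restrict T) ∈ hormanderSpace k := by
  obtain ⟨f, hf, hTf, hkf⟩ := exists_measurable_of_mem_hormanderSpace hT
  exact ⟨_, hk.isFunction_prodHat χ hf hkf hTf, hk.memLp_prodHat χ hf hkf⟩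

theorem GrowthBound.hormanderNorm_smulDistr_le (hk : IsWeight k) (hC : 0 < C)
    (h : GrowthBound k C N) (χ : Test n) {T : 𝓢'(Rn n, ℂ)} (hT : T ∈ hormanderSpace k) :
    hormanderNorm k (smulDistr χ (restrict T)) ≤ multiplierConst C N χ * hormanderNorm k T := by
  obtain ⟨f, hf, hTf, hkf⟩ := exists_measurable_of_mem_hormanderSpace hT
  rw [hormanderNorm_eq hTf, hormanderNorm_eq (hk.isFunction_prodHat χ hf hkf hTf)]
  exact h.eLpNorm_prodHat_le hk hC χ hf

/-! ### The control function of an element of `𝓑_k` -/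

/-- Translation by `y` multiplies `χ̂(ξ-η)` by `e^{-i⟨y, ξ⟩} e^{i⟨y, η⟩}`. The first factor is
unimodular and leaves the integral; the second is a Fourier kernel in `(y, η)`. -/
theorem enorm_prodHat_translate (y : Rn n) (χ : Test n) (f : Rn n → ℂ) (ξ : Rn n) :
    ‖prodHat (translate y χ) f ξ‖ₑ = ‖(inversionConst n : ℂ)‖ₑ *
      ‖∫ η, Complex.exp (Complex.I * (inner ℝ y η : ℝ)) *
        (hat n χ.toSchwartz (ξ - η) * f η)‖ₑ := by
  have e : ∫ η, hat n (translate y χ).toSchwartz (ξ - η) * f η =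
      Complex.exp (-Complex.I * (inner ℝ y ξ : ℝ)) *
      ∫ η, Complex.exp (Complex.I * (inner ℝ y η : ℝ)) * (hat n χ.toSchwartz (ξ - η) * f η) := by
    rw [← integral_const_mul]
    refine integral_congr_ae (.of_forall fun η => ?_)
    simp only [hat_translate, inner_sub_right]
    rw [← mul_assoc, ← mul_assoc, ← Complex.exp_add]
    congr 3
    push_cast
    ring
  have h1 : ‖Complex.exp (-Complex.I * (inner ℝ y ξ : ℝ))‖ₑ = 1 := by
    rw [← ofReal_norm, Complex.norm_exp]
    simp
  rw [prodHat, e, enorm_mul, enorm_mul, h1, one_mul]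

theorem measurable_enorm_prodHat_translate (hk : IsWeight k) (χ : Test n) {f : Rn n → ℂ}
    (hf : Measurable f) : Measurable (Function.uncurry fun (y ξ : Rn n) =>
      ‖(k ξ : ℂ) * prodHat (translate y χ) f ξ‖ₑ ^ 2) := by
  simp only [enorm_mul, enorm_prodHat_translate]
  have hφ := (hat n χ.toSchwartz).continuous.measurable
  have hkm := hk.measurable
  have hc : Measurable fun p : (Rn n × Rn n) × Rn n =>
      Complex.exp (Complex.I * (inner ℝ p.1.1 p.2 : ℝ)) := Continuous.measurable (by fun_prop)
  have hm : Measurable fun p : (Rn n × Rn n) × Rn n =>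
      Complex.exp (Complex.I * (inner ℝ p.1.1 p.2 : ℝ)) *
        (hat n χ.toSchwartz (p.1.2 - p.2) * f p.2) := by fun_prop
  have hI : Measurable fun p : Rn n × Rn n => ∫ η,
      Complex.exp (Complex.I * (inner ℝ p.1 η : ℝ)) * (hat n χ.toSchwartz (p.2 - η) * f η) :=
    hm.stronglyMeasurable.integral_prod_right'.measurable
  unfold Function.uncurry
  fun_prop

theorem IsWeight.control_eq (hk : IsWeight k) (χ : Test n) {T : 𝓢'(Rn n, ℂ)} {f : Rn n → ℂ}
    (hf : Measurable f) (hkf : MemLp (fun ξ => (k ξ : ℂ) * f ξ) 2)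
    (hT : IsFunction (hatDistr T) f) (y : Rn n) :
    control k χ (restrict T) y =
      eLpNorm (fun ξ => (k ξ : ℂ) * prodHat (translate y χ) f ξ) 2 volume :=
  hormanderNorm_eq (hk.isFunction_prodHat _ hf hkf hT)

theorem IsWeight.measurable_control (hk : IsWeight k) (χ : Test n) {T : 𝓢'(Rn n, ℂ)}
    (hT : T ∈ hormanderSpace k) : Measurable (control k χ (restrict T)) := by
  obtain ⟨f, hf, hTf, hkf⟩ := exists_measurable_of_mem_hormanderSpace hT
  have e : control k χ (restrict T) = fun y =>
      (∫⁻ ξ, ‖(k ξ : ℂ) * prodHat (translate y χ) f ξ‖ₑ ^ 2) ^ (1 / 2 : ℝ) := by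
    funext y
    rw [hk.control_eq χ hf hkf hTf, lintegral_enorm_sq_eq_eLpNorm_sq, ← ENNReal.rpow_natCast,
      ← ENNReal.rpow_mul]
    norm_num
  rw [e]
  exact (Measurable.lintegral_prod_right (measurable_enorm_prodHat_translate hk χ hf)).pow_const _

/-- Being an equality, this gives the upper and the lower norm bound alike: Tonelli brings the
`y`-integral inside, and Plancherel evaluates it for each fixed `ξ`. -/
theorem IsWeight.katoNorm_sq_eq (hk : IsWeight k) (χ : Test n) {T : 𝓢'(Rn n, ℂ)} {f : Rn n → ℂ}
    (hf : Measurable f) (hkf : MemLp (fun ξ => (k ξ : ℂ) * f ξ) 2)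
    (hT : IsFunction (hatDistr T) f) :
    katoNorm k 2 χ (restrict T) ^ 2 = ‖(inversionConst n : ℂ)‖ₑ ^ 2 * plancherelConst n *
      ∫⁻ ξ, ∫⁻ η, (‖(k ξ : ℂ)‖ₑ * ‖hat n χ.toSchwartz (ξ - η)‖ₑ * ‖f η‖ₑ) ^ 2 := by
  have hφ := (hat n χ.toSchwartz).continuous.measurable
  have hkm := hk.measurable
  have hc : ∀ ξ : Rn n, Measurable fun y : Rn n => ∫ η,
      Complex.exp (Complex.I * (inner ℝ y η : ℝ)) * (hat n χ.toSchwartz (ξ - η) * f η) := by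
    intro ξ
    have h1 : Measurable fun p : Rn n × Rn n => Complex.exp (Complex.I * (inner ℝ p.1 p.2 : ℝ)) :=
      Continuous.measurable (by fun_prop)
    have hm : Measurable fun p : Rn n × Rn n =>
      Complex.exp (Complex.I * (inner ℝ p.1 p.2 : ℝ)) *
        (hat n χ.toSchwartz (ξ - p.2) * f p.2) := by fun_prop
    exact hm.stronglyMeasurable.integral_prod_right'.measurable
  rw [katoNorm, ← lintegral_enorm_sq_eq_eLpNorm_sq]
  calc ∫⁻ y, ‖control k χ (restrict T) y‖ₑ ^ 2
      = ∫⁻ y, ∫⁻ ξ, ‖(k ξ : ℂ) * prodHat (translate y χ) f ξ‖ₑ ^ 2 := by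
        refine lintegral_congr fun y => ?_
        rw [lintegral_enorm_sq_eq_eLpNorm_sq, hk.control_eq χ hf hkf hT, enorm_eq_self]
    _ = ∫⁻ ξ, ∫⁻ y, ‖(k ξ : ℂ) * prodHat (translate y χ) f ξ‖ₑ ^ 2 :=
        lintegral_lintegral_swap (measurable_enorm_prodHat_translate hk χ hf).aemeasurable
    _ = ∫⁻ ξ, ‖(inversionConst n : ℂ)‖ₑ ^ 2 * plancherelConst n *
          ∫⁻ η, (‖(k ξ : ℂ)‖ₑ * ‖hat n χ.toSchwartz (ξ - η)‖ₑ * ‖f η‖ₑ) ^ 2 := by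
        refine lintegral_congr fun ξ => ?_
        simp only [enorm_mul, enorm_prodHat_translate, mul_pow, mul_assoc]
        rw [lintegral_const_mul _ (by have := hc ξ; fun_prop),
          lintegral_const_mul _ (by have := hc ξ; fun_prop),
          lintegral_enorm_sq_integral_exp (hk.integrable_sub_mul _ hkf ξ)
            (hk.memLp_sub_mul _ hkf ξ), lintegral_const_mul _ (by fun_prop)]
        simp only [enorm_mul, mul_pow]
        ring
    _ = _ := by
        refine lintegral_const_mul _ (Measurable.lintegral_prod_right ?_)
        fun_prop

theorem lintegral_lintegral_sub_mul {a b : Rn n → ℝ≥0∞} (ha : Measurable a) (hb : Measurable b) :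
    ∫⁻ ξ, ∫⁻ η, a (ξ - η) * b η = (∫⁻ ζ, a ζ) * ∫⁻ η, b η := by
  rw [lintegral_lintegral_swap (by fun_prop), ← lintegral_const_mul _ hb]
  refine lintegral_congr fun η => ?_
  rw [lintegral_mul_const _ (by fun_prop), lintegral_sub_right_eq_self]

theorem GrowthBound.katoNorm_sq_le (hk : IsWeight k) (hC : 0 < C) (h : GrowthBound k C N)
    (χ : Test n) {T : 𝓢'(Rn n, ℂ)} (hT : T ∈ hormanderSpace k) :
    katoNorm k 2 χ (restrict T) ^ 2 ≤ ‖(inversionConst n : ℂ)‖ₑ ^ 2 * plancherelConst n *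
      (ENNReal.ofReal C ^ 2 * ∫⁻ ζ, ‖bracketMul N (hat n χ.toSchwartz) ζ‖ₑ ^ 2) *
        hormanderNorm k T ^ 2 := by
  obtain ⟨f, hf, hTf, hkf⟩ := exists_measurable_of_mem_hormanderSpace hT
  have hφ := (bracketMul N (hat n χ.toSchwartz)).continuous.measurable
  have hkm := hk.measurable
  rw [hk.katoNorm_sq_eq χ hf hkf hTf, hormanderNorm_eq hTf, ← lintegral_enorm_sq_eq_eLpNorm_sq,
    mul_assoc (_ * _)]
  gcongr
  rw [← lintegral_const_mul (ENNReal.ofReal C ^ 2) (by fun_prop),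
    ← lintegral_lintegral_sub_mul (by fun_prop) (by fun_prop)]
  refine lintegral_mono fun ξ => lintegral_mono fun η => ?_
  rw [← mul_pow, ← mul_pow]
  refine pow_le_pow_left' ?_ 2
  rw [bracketMul_apply, enorm_mul, enorm_mul]
  calc _ ≤ (ENNReal.ofReal C * ‖(bracket N (ξ - η) : ℂ)‖ₑ * ‖(k η : ℂ)‖ₑ) *
        ‖hat n χ.toSchwartz (ξ - η)‖ₑ * ‖f η‖ₑ := by gcongr; exact h.enorm_le hk hC ξ η
    _ = _ := by ring

theorem bracket_neg_mul_bracket (N : ℝ) (ξ : Rn n) : bracket (-N) ξ * bracket N ξ = 1 := by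
  rw [bracket_eq, bracket_eq, ← Real.rpow_add (by positivity), neg_div, neg_add_cancel,
    Real.rpow_zero]

/-- Here the growth bound is used with the roles exchanged, `k(η) ≤ C ⟨η-ξ⟩ ^ N k(ξ)`; the exponent
`-N` on `χ̂` cancels the bracket this creates. -/
theorem GrowthBound.le_katoNorm_sq (hk : IsWeight k) (hC : 0 < C) (h : GrowthBound k C N)
    (χ : Test n) {T : 𝓢'(Rn n, ℂ)} (hT : T ∈ hormanderSpace k) :
    ‖(inversionConst n : ℂ)‖ₑ ^ 2 * plancherelConst n *
      (∫⁻ ζ, ‖bracketMul (-N) (hat n χ.toSchwartz) ζ‖ₑ ^ 2) * hormanderNorm k T ^ 2 ≤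
      ENNReal.ofReal C ^ 2 * katoNorm k 2 χ (restrict T) ^ 2 := by
  obtain ⟨f, hf, hTf, hkf⟩ := exists_measurable_of_mem_hormanderSpace hT
  have hφ := (bracketMul (-N) (hat n χ.toSchwartz)).continuous.measurable
  have hφ' := (hat n χ.toSchwartz).continuous.measurable
  have hkm := hk.measurable
  rw [hk.katoNorm_sq_eq χ hf hkf hTf, hormanderNorm_eq hTf, ← lintegral_enorm_sq_eq_eLpNorm_sq,
    mul_assoc (_ * _), mul_left_comm (ENNReal.ofReal C ^ 2)]
  refine mul_le_mul_right ?_ _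
  rw [← lintegral_lintegral_sub_mul (by fun_prop) (by fun_prop), ← lintegral_const_mul _
    (Measurable.lintegral_prod_right (by fun_prop))]
  refine lintegral_mono fun ξ => ?_
  simp only
  rw [← lintegral_const_mul _ (by fun_prop)]
  refine lintegral_mono fun η => ?_
  simp only
  rw [← mul_pow, ← mul_pow]
  refine pow_le_pow_left' ?_ 2
  rw [bracketMul_apply, enorm_mul, enorm_mul]
  have hb : ‖(bracket (-N) (ξ - η) : ℂ)‖ₑ * ‖(bracket N (η - ξ) : ℂ)‖ₑ = 1 := by
    rw [bracket_sub_comm N, ← enorm_mul, ← Complex.ofReal_mul, bracket_neg_mul_bracket]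
    simp
  calc _ ≤ ‖(bracket (-N) (ξ - η) : ℂ)‖ₑ * ‖hat n χ.toSchwartz (ξ - η)‖ₑ *
        ((ENNReal.ofReal C * ‖(bracket N (η - ξ) : ℂ)‖ₑ * ‖(k ξ : ℂ)‖ₑ) * ‖f η‖ₑ) := by
        gcongr
        exact h.enorm_le hk hC η ξ
    _ = (‖(bracket (-N) (ξ - η) : ℂ)‖ₑ * ‖(bracket N (η - ξ) : ℂ)‖ₑ) *
        (ENNReal.ofReal C * (‖(k ξ : ℂ)‖ₑ * ‖hat n χ.toSchwartz (ξ - η)‖ₑ * ‖f η‖ₑ)) := by ring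
    _ = _ := by rw [hb, one_mul]

/-- The lower bound is useful only if its constant is positive, which follows from continuity of
`χ̂` and injectivity of the Fourier transform. -/
theorem lintegral_bracketMul_hat_ne_zero {χ : Test n} (hχ : χ ≠ 0) (N : ℝ) :
    ∫⁻ ζ, ‖bracketMul N (hat n χ.toSchwartz) ζ‖ₑ ^ 2 ≠ 0 := by
  set ψ := bracketMul N (hat n χ.toSchwartz) with hψ
  intro h0
  rw [lintegral_eq_zero_iff (by have := ψ.continuous.measurable; fun_prop)] at h0
  have h1 : (ψ : Rn n → ℂ) = 0 := by
    refine (Continuous.ae_eq_iff_eq volume ψ.continuous continuous_zero).1 ?_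
    filter_upwards [h0] with ζ hζ
    simpa using hζ
  apply hχ
  have h2 : hat n χ.toSchwartz = 0 := by
    ext ζ
    have := congrFun h1 ζ
    rw [hψ, bracketMul_apply] at this
    simpa [(bracket_pos N ζ).ne'] using this
  have h3 : χ.toSchwartz = 0 := by rw [← hatInv_hat χ.toSchwartz, h2, map_zero]
  ext x
  exact congrArg (fun φ : 𝓢(Rn n, ℂ) => φ x) h3

/-- The norms of `𝓑_k` and `𝓑_k^2` are equivalent on `𝓑_k`. -/
theorem IsWeight.exists_norm_equiv (hk : IsWeight k) {χ : Test n} (hχ : χ ≠ 0) :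
    ∃ C : ℝ≥0, 0 < C ∧ ∀ T ∈ hormanderSpace k,
      katoNorm k 2 χ (restrict T) ≤ C * hormanderNorm k T ∧
      hormanderNorm k T ≤ C * katoNorm k 2 χ (restrict T) := by
  obtain ⟨C, N, hC, h⟩ := hk.exists_growthBound
  have hfin : ∀ M : ℝ, ∫⁻ ζ, ‖bracketMul M (hat n χ.toSchwartz) ζ‖ₑ ^ 2 ≠ ⊤ := fun M => by
    rw [lintegral_enorm_sq_eq_eLpNorm_sq]
    exact (ENNReal.pow_lt_top (SchwartzMap.eLpNorm_lt_top _ 2 volume)).ne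
  set c := ‖(inversionConst n : ℂ)‖ₑ ^ 2 * plancherelConst n with hc
  have hc0 : c ≠ 0 := by
    refine mul_ne_zero (pow_ne_zero 2 ?_) (plancherelConst_ne_zero n)
    simpa using (inversionConst_pos n).ne'
  have hct : c ≠ ⊤ := ENNReal.mul_ne_top (ENNReal.pow_ne_top enorm_ne_top) (plancherelConst_ne_top n)
  set A := c * (ENNReal.ofReal C ^ 2 * ∫⁻ ζ, ‖bracketMul N (hat n χ.toSchwartz) ζ‖ₑ ^ 2) with hA
  set B := c * ∫⁻ ζ, ‖bracketMul (-N) (hat n χ.toSchwartz) ζ‖ₑ ^ 2 with hB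
  have hAt : A ≠ ⊤ := ENNReal.mul_ne_top hct
    (ENNReal.mul_ne_top (ENNReal.pow_ne_top ENNReal.ofReal_ne_top) (hfin N))
  have hB0 : B ≠ 0 := mul_ne_zero hc0 (lintegral_bracketMul_hat_ne_zero hχ (-N))
  have hBt : B ≠ ⊤ := ENNReal.mul_ne_top hct (hfin (-N))
  -- `A` and `B⁻¹ C²` bound the squared norms. Adding `1` ensures `D ≤ D²`, so `D` itself serves for
  -- the norms without square roots.
  set D := A + B⁻¹ * ENNReal.ofReal C ^ 2 + 1 with hD
  have hDt : D ≠ ⊤ := by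
    simp only [hD, ne_eq, ENNReal.add_eq_top, not_or, hAt, not_false_eq_true, true_and,
      ENNReal.one_ne_top, and_true]
    exact ENNReal.mul_ne_top (ENNReal.inv_ne_top.2 hB0) (ENNReal.pow_ne_top ENNReal.ofReal_ne_top)
  have hD1 : 1 ≤ D := le_add_self
  have hDD : D ≤ D ^ 2 := by
    rw [sq]
    exact le_mul_of_one_le_left' hD1
  refine ⟨D.toNNReal, ENNReal.toNNReal_pos (zero_lt_one.trans_le hD1).ne' hDt, fun T hT => ?_⟩
  rw [ENNReal.coe_toNNReal hDt]
  constructor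
  · rw [← ENNReal.pow_le_pow_left_iff (n := 2) two_ne_zero, mul_pow]
    refine (h.katoNorm_sq_le hk hC χ hT).trans ?_
    gcongr
    refine le_trans ?_ hDD
    rw [hD, add_assoc]
    exact le_self_add
  · rw [← ENNReal.pow_le_pow_left_iff (n := 2) two_ne_zero, mul_pow]
    have h1 := h.le_katoNorm_sq hk hC χ hT
    calc hormanderNorm k T ^ 2 = B⁻¹ * (B * hormanderNorm k T ^ 2) := by
          rw [← mul_assoc, ENNReal.inv_mul_cancel hB0 hBt, one_mul]
      _ ≤ B⁻¹ * (ENNReal.ofReal C ^ 2 * katoNorm k 2 χ (restrict T) ^ 2) := by gcongr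
      _ = (B⁻¹ * ENNReal.ofReal C ^ 2) * katoNorm k 2 χ (restrict T) ^ 2 := by rw [mul_assoc]
      _ ≤ _ := by
          gcongr
          refine le_trans ?_ hDD
          rw [hD]
          exact le_add_self.trans le_self_add

theorem hormanderNorm_lt_top {T : 𝓢'(Rn n, ℂ)} (hT : T ∈ hormanderSpace k) :
    hormanderNorm k T < ⊤ := by
  obtain ⟨f, hf, hkf⟩ := hT
  rw [hormanderNorm_eq hf]
  exact hkf.2

theorem IsWeight.memLp_control (hk : IsWeight k) {χ : Test n} (hχ : χ ≠ 0) {T : 𝓢'(Rn n, ℂ)}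
    (hT : T ∈ hormanderSpace k) : MemLp (control k χ (restrict T)) 2 volume := by
  obtain ⟨C, -, h⟩ := hk.exists_norm_equiv hχ
  refine ⟨(hk.measurable_control χ hT).aestronglyMeasurable, ?_⟩
  exact (h T hT).1.trans_lt (ENNReal.mul_lt_top ENNReal.coe_lt_top (hormanderNorm_lt_top hT))

/-! ### Local membership in `𝓑_k` -/

theorem zero_mem_hormanderSpace : (0 : 𝓢'(Rn n, ℂ)) ∈ hormanderSpace k := by
  refine ⟨0, ⟨locallyIntegrable_zero, fun φ => ⟨by simp, ?_⟩⟩, by simp⟩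
  simp [hatDistr_apply]

theorem add_mem_hormanderSpace {S T : 𝓢'(Rn n, ℂ)} (hS : S ∈ hormanderSpace k)
    (hT : T ∈ hormanderSpace k) : S + T ∈ hormanderSpace k := by
  obtain ⟨f, hf, hkf⟩ := hS
  obtain ⟨g, hg, hkg⟩ := hT
  refine ⟨f + g, ⟨hf.1.add hg.1, fun φ => ?_⟩, ?_⟩
  · have h1 := (hf.2 φ).1
    have h2 := (hg.2 φ).1
    simp only [Pi.add_apply, mul_add]
    refine ⟨h1.add h2, ?_⟩
    rw [integral_add h1 h2, ← (hf.2 φ).2, ← (hg.2 φ).2]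
    rfl
  · simp only [Pi.add_apply, mul_add]
    exact hkf.add hkg

theorem sum_mem_hormanderSpace {ι : Type*} (t : Finset ι) (S : ι → 𝓢'(Rn n, ℂ))
    (hS : ∀ i ∈ t, S i ∈ hormanderSpace k) : ∑ i ∈ t, S i ∈ hormanderSpace k :=
  Finset.sum_induction S (· ∈ hormanderSpace k) (fun _ _ => add_mem_hormanderSpace)
    zero_mem_hormanderSpace hS

theorem smulDistr_eq_sum {ι : Type*} (t : Finset ι) (φ : Test n) (ψ χ : ι → Test n)
    (h : ∀ x, φ x = ∑ i ∈ t, ψ i x * χ i x) (u : Distr n) :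
    smulDistr φ u = ∑ i ∈ t, smulDistr (ψ i) (restrict (smulDistr (χ i) u)) := by
  ext g
  have e : mulTest φ g = ∑ i ∈ t, mulTest (χ i) (mulTest (ψ i) g).toSchwartz := by
    ext x
    rw [mulTest_apply, h, Finset.sum_mul]
    rw [sum_apply]
    refine Finset.sum_congr rfl fun i _ => ?_
    rw [mulTest_apply, Test.toSchwartz_apply, mulTest_apply]
    ring
  rw [smulDistr_apply, e, map_sum, sum_apply]
  rfl

/-- By compactness finitely many translates of `{χ ≠ 0}` cover `supp φ`. There `s = ∑ |τ_y χ|²` is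
positive, and `ψ_y = (φ / s) · conj (τ_y χ)` works; the conjugate rules out cancellation in the sum.
-/
theorem exists_eq_sum_mul_translate {χ : Test n} (hχ : χ ≠ 0) (φ : Test n) :
    ∃ (t : Finset (Rn n)) (ψ : Rn n → Test n),
      ∀ x, φ x = ∑ y ∈ t, ψ y x * translate y χ x := by
  obtain ⟨x₀, hx₀⟩ : ∃ x, χ x ≠ 0 := by
    by_contra! h
    exact hχ (TestFunction.ext h)
  obtain ⟨t, ht⟩ := IsCompact.elim_finite_subcover φ.hasCompactSupport
    (fun y : Rn n => {x | translate y χ x ≠ 0})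
    (fun y => isOpen_ne_fun (translate y χ).continuous continuous_const)
    (fun x _ => Set.mem_iUnion.2 ⟨x - x₀, by
      simpa [translate_apply] using hx₀⟩)
  set s : Rn n → ℂ := fun x => ∑ y ∈ t, (starRingEnd ℂ) (translate y χ x) * translate y χ x with hs
  have hs0 : ∀ x ∈ tsupport φ, s x ≠ 0 := by
    intro x hx
    have e : s x = ((∑ y ∈ t, ‖translate y χ x‖ ^ 2 : ℝ) : ℂ) := by
      simp only [hs, Complex.conj_mul']
      push_cast
      rfl
    rw [e, Complex.ofReal_ne_zero]
    obtain ⟨y, hy, hxy⟩ := Set.mem_iUnion₂.1 (ht hx)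
    refine (Finset.sum_pos' (fun _ _ => by positivity) ⟨y, hy, ?_⟩).ne'
    have : 0 < ‖translate y χ x‖ := norm_pos_iff.2 hxy
    positivity
  have hsm : ContDiff ℝ ∞ s :=
    ContDiff.sum fun y _ => ((Complex.conjCLE.contDiff.comp (translate y χ).contDiff).mul
      (translate y χ).contDiff)
  have hq : ContDiff ℝ ∞ fun x => φ x / s x := by
    rw [contDiff_iff_contDiffAt]
    intro x
    by_cases hx : x ∈ tsupport φ
    · simp only [div_eq_mul_inv]
      exact φ.contDiff.contDiffAt.mul (hsm.contDiffAt.inv (hs0 x hx))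
    -- Off `supp φ` the numerator vanishes nearby, so zeros of `s` do no harm.
    · refine (contDiffAt_const (c := (0 : ℂ))).congr_of_eventuallyEq ?_
      filter_upwards [notMem_tsupport_iff_eventuallyEq.1 hx] with z hz
      simp [hz]
  let ψ : Rn n → Test n := fun y =>
    { toFun := fun x => φ x / s x * (starRingEnd ℂ) (translate y χ x)
      contDiff' := hq.mul (Complex.conjCLE.contDiff.comp (translate y χ).contDiff)
      hasCompactSupport' := by
        refine φ.hasCompactSupport.mono fun x hx => ?_
        rw [Function.mem_support] at hx ⊢
        contrapose! hx
        simp [hx]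
      tsupport_subset' := Set.subset_univ _ }
  refine ⟨t, ψ, fun x => ?_⟩
  have e : ∑ y ∈ t, ψ y x * translate y χ x = φ x / s x * s x := by
    simp only [hs, Finset.mul_sum]
    refine Finset.sum_congr rfl fun y _ => ?_
    change φ x / s x * (starRingEnd ℂ) (translate y χ x) * translate y χ x = _
    rw [mul_assoc]
  rw [e]
  by_cases hx : x ∈ tsupport φ
  · rw [div_mul_cancel₀ _ (hs0 x hx)]
  · simp [image_eq_zero_of_notMem_tsupport hx]

theorem IsWeight.mem_hormanderLoc (hk : IsWeight k) {χ : Test n} (hχ : χ ≠ 0) {u : Distr n}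
    (hu : ∀ y, smulDistr (translate y χ) u ∈ hormanderSpace k) : u ∈ hormanderLoc k := by
  intro φ
  obtain ⟨t, ψ, h⟩ := exists_eq_sum_mul_translate hχ φ
  rw [smulDistr_eq_sum t φ ψ (fun y => translate y χ) h u]
  exact sum_mem_hormanderSpace t _ fun y _ => hk.smulDistr_mem _ (hu y)

/-! ### Cutoff functions -/

/-- The dilated test function `x ↦ χ(x / R)`. -/
def dilateTest (R : ℝ) (hR : 0 < R) (χ : Test n) : Test n where
  toFun x := χ (R⁻¹ • x)
  contDiff' := χ.contDiff.comp (contDiff_const_smul _)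
  hasCompactSupport' := by
    simpa [Function.comp_def] using
      χ.hasCompactSupport.comp_homeomorph (Homeomorph.smulOfNeZero R⁻¹ (inv_ne_zero hR.ne'))
  tsupport_subset' := Set.subset_univ _

theorem dilateTest_apply (R : ℝ) (hR : 0 < R) (χ : Test n) (x : Rn n) :
    dilateTest R hR χ x = χ (R⁻¹ • x) := rfl

theorem hat_dilateTest (R : ℝ) (hR : 0 < R) (χ : Test n) (ξ : Rn n) :
    hat n (dilateTest R hR χ).toSchwartz ξ = (R ^ n : ℝ) * hat n χ.toSchwartz (R • ξ) := by
  have h := Measure.integral_comp_smul (volume : Measure (Rn n))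
    (fun x => Complex.exp (-Complex.I * (inner ℝ x (R • ξ) : ℝ)) * χ x) R⁻¹
  rw [finrank_euclideanSpace_fin, inv_pow, inv_inv, abs_of_pos (by positivity),
    Complex.real_smul] at h
  rw [hat_apply, hat_apply]
  refine Eq.trans ?_ h
  refine integral_congr_ae (.of_forall fun x => ?_)
  simp only [Test.toSchwartz_apply, dilateTest_apply, inner_smul_left, inner_smul_right]
  simp [hR.ne']

/-- `GrowthBound` leaves the sign of `N` open; passing to `|N|` makes the bracket increasing in the
norm. -/
theorem bracket_smul_le {R : ℝ} (hR : 1 ≤ R) (N : ℝ) (ξ : Rn n) :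
    bracket N (R⁻¹ • ξ) ≤ bracket |N| ξ := by
  have h1 : ∀ ζ : Rn n, 1 ≤ Real.sqrt (1 + ‖ζ‖ ^ 2) := fun ζ => by
    rw [Real.one_le_sqrt]
    nlinarith [sq_nonneg ‖ζ‖]
  have h2 : ‖R⁻¹ • ξ‖ ≤ ‖ξ‖ := by
    rw [norm_smul, norm_inv, Real.norm_of_nonneg (by linarith)]
    exact mul_le_of_le_one_left (norm_nonneg _) (inv_le_one_of_one_le₀ hR)
  calc bracket N (R⁻¹ • ξ) ≤ bracket |N| (R⁻¹ • ξ) :=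
        Real.rpow_le_rpow_of_exponent_le (h1 _) (le_abs_self N)
    _ ≤ bracket |N| ξ := by
        unfold bracket
        gcongr

/-- The transform of `χ(·/R)` is `Rⁿ χ̂(R ·)`: its `L¹` norm does not depend on `R`, and for `R ≥ 1`
concentration near `0` does not increase the bracket weight beyond `⟨·⟩ ^ |N|`. -/
theorem multiplierConst_dilateTest_le {R : ℝ} (hR : 1 ≤ R) (C N : ℝ) (χ : Test n) :
    multiplierConst C N (dilateTest R (by linarith) χ) ≤ multiplierConst C |N| χ := by
  have hR0 : 0 < R := by linarith
  unfold multiplierConst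
  gcongr _ * (_ * ?_)
  have e : ∀ ζ : Rn n, ‖bracketMul N (hat n (dilateTest R hR0 χ).toSchwartz) ζ‖ₑ ≤
      ENNReal.ofReal (R ^ n) * ‖bracketMul |N| (hat n χ.toSchwartz) (R • ζ)‖ₑ := by
    intro ζ
    have hb := bracket_smul_le hR N (R • ζ)
    rw [smul_smul, inv_mul_cancel₀ hR0.ne', one_smul] at hb
    rw [← ofReal_norm, ← ofReal_norm, ← ENNReal.ofReal_mul (by positivity)]
    refine ENNReal.ofReal_le_ofReal ?_
    rw [bracketMul_apply, bracketMul_apply, hat_dilateTest, norm_mul, norm_mul, norm_mul,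
      norm_bracket, norm_bracket, Complex.norm_real, Real.norm_of_nonneg (by positivity)]
    calc _ ≤ bracket |N| (R • ζ) * (R ^ n * ‖hat n χ.toSchwartz (R • ζ)‖) := by gcongr
      _ = _ := by ring
  refine (lintegral_mono e).trans_eq ?_
  rw [lintegral_const_mul' _ _ ENNReal.ofReal_ne_top,
    lintegral_comp_smul (fun ζ => ‖bracketMul |N| (hat n χ.toSchwartz) ζ‖ₑ) hR0.ne', ← mul_assoc,
    ← ENNReal.ofReal_mul (by positivity), abs_of_pos (by positivity),
    mul_inv_cancel₀ (by positivity), ENNReal.ofReal_one, one_mul]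

theorem exists_test_eq_one (n : ℕ) : ∃ θ : Test n, ∀ x, ‖x‖ ≤ 1 → θ x = 1 := by
  let b : ContDiffBump (0 : Rn n) := ⟨1, 2, by norm_num, by norm_num⟩
  refine ⟨⟨fun x => (b x : ℂ), Complex.ofRealCLM.contDiff.comp b.contDiff,
    b.hasCompactSupport.comp_left (g := Complex.ofReal) rfl, Set.subset_univ _⟩, fun x hx => ?_⟩
  change ((b x : ℝ) : ℂ) = 1
  rw [b.one_of_mem_closedBall (by simpa using hx), Complex.ofReal_one]

theorem exists_test_ne_zero (n : ℕ) : ∃ θ : Test n, θ ≠ 0 := by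
  obtain ⟨θ, hθ⟩ := exists_test_eq_one n
  refine ⟨θ, fun h => ?_⟩
  have := hθ 0 (by simp)
  rw [h] at this
  exact zero_ne_one this

/-! ### Global membership in `𝓑_k` -/

theorem smulDistr_restrict_smulDistr_comm (φ χ : Test n) (u : Distr n) :
    smulDistr φ (restrict (smulDistr χ u)) = smulDistr χ (restrict (smulDistr φ u)) := by
  ext g
  change u (mulTest χ (mulTest φ g).toSchwartz) = u (mulTest φ (mulTest χ g).toSchwartz)
  congr 1
  ext x
  simp only [mulTest_apply, Test.toSchwartz_apply]
  ring

/-- Cutoff and window commute, `(θ u) τ_y χ = θ (u τ_y χ)`, so the multiplier bound applies for each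
`y`. -/
theorem GrowthBound.katoNorm_smulDistr_le (hk : IsWeight k) (hC : 0 < C) (h : GrowthBound k C N)
    (χ θ : Test n) {u : Distr n} (hu : u ∈ hormanderLoc k) :
    katoNorm k 2 χ (restrict (smulDistr θ u)) ≤ multiplierConst C N θ * katoNorm k 2 χ u := by
  rw [← ENNReal.pow_le_pow_left_iff (n := 2) two_ne_zero, mul_pow, katoNorm, katoNorm,
    ← lintegral_enorm_sq_eq_eLpNorm_sq, ← lintegral_enorm_sq_eq_eLpNorm_sq,
    ← lintegral_const_mul' _ _ (ENNReal.pow_ne_top (multiplierConst_lt_top C N θ).ne)]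
  refine lintegral_mono fun y => ?_
  rw [← mul_pow]
  refine pow_le_pow_left' ?_ 2
  simp only [enorm_eq_self, control]
  rw [smulDistr_restrict_smulDistr_comm]
  exact h.hormanderNorm_smulDistr_le hk hC θ (hu _)

/-- Cauchy-Schwarz for the pairing on the Fourier side, with weights `k⁻¹` and `k`. -/
theorem IsWeight.enorm_apply_le (hk : IsWeight k) {T : 𝓢'(Rn n, ℂ)} (hT : T ∈ hormanderSpace k)
    (φ : 𝓢(Rn n, ℂ)) :
    ‖T φ‖ₑ ≤ eLpNorm (fun ξ => hatInv n φ ξ / (k ξ : ℂ)) 2 volume * hormanderNorm k T := by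
  obtain ⟨f, hf, hTf, hkf⟩ := exists_measurable_of_mem_hormanderSpace hT
  have e : T φ = ∫ ξ, hatInv n φ ξ * f ξ := by
    rw [← (hTf.2 (hatInv n φ)).2, hatDistr_apply, hat_hatInv]
  have hm := (hatInv n φ).continuous.measurable
  have hkm := hk.measurable
  rw [e, hormanderNorm_eq hTf, ← ENNReal.pow_le_pow_left_iff (n := 2) two_ne_zero, mul_pow,
    ← lintegral_enorm_sq_eq_eLpNorm_sq, ← lintegral_enorm_sq_eq_eLpNorm_sq]
  refine le_trans (pow_le_pow_left' ?_ 2) (sq_lintegral_mul_le volume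
    (f := fun ξ => ‖hatInv n φ ξ / (k ξ : ℂ)‖ₑ) (g := fun ξ => ‖(k ξ : ℂ) * f ξ‖ₑ)
    (by fun_prop) (by fun_prop))
  refine (enorm_integral_le_lintegral_enorm _).trans_eq (lintegral_congr fun ξ => ?_)
  rw [← enorm_mul, ← mul_assoc, div_mul_cancel₀ _ (hk.ofReal_ne_zero ξ)]

theorem IsWeight.exists_enorm_apply_le (hk : IsWeight k) {χ : Test n} (hχ : χ ≠ 0) {u : Distr n}
    (hu : u ∈ hormanderLoc k) (hu' : katoNorm k 2 χ u < ⊤) : ∃ M : ℝ≥0, ∀ φ : Test n,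
      ‖u φ‖ₑ ≤ M * eLpNorm (fun ξ => hatInv n φ.toSchwartz ξ / (k ξ : ℂ)) 2 volume := by
  obtain ⟨C, N, hC, h⟩ := hk.exists_growthBound
  obtain ⟨D, -, hD⟩ := hk.exists_norm_equiv hχ
  obtain ⟨θ, hθ⟩ := exists_test_eq_one n
  -- A bound for the `𝓑_k` norm of every `θ(·/R) u` with `R ≥ 1`; a large `R` makes this cutoff
  -- equal `1` on `supp φ`.
  set M : ℝ≥0∞ := D * (multiplierConst C |N| θ * katoNorm k 2 χ u) with hM
  have hMt : M ≠ ⊤ := ENNReal.mul_ne_top ENNReal.coe_ne_top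
    (ENNReal.mul_ne_top (multiplierConst_lt_top C |N| θ).ne hu'.ne)
  refine ⟨M.toNNReal, fun φ => ?_⟩
  rw [ENNReal.coe_toNNReal hMt]
  obtain ⟨R, hR⟩ := φ.hasCompactSupport.isBounded.exists_norm_le
  have hR1 : 1 ≤ max R 1 := le_max_right _ _
  have hR0 : 0 < max R 1 := by linarith
  set θR := dilateTest (max R 1) hR0 θ with hθR
  have e : u φ = smulDistr θR u φ.toSchwartz := by
    rw [smulDistr_apply]
    congr 1
    ext x
    rw [mulTest_apply, Test.toSchwartz_apply]
    by_cases hx : x ∈ tsupport φ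
    · rw [hθR, dilateTest_apply, hθ, one_mul]
      rw [norm_smul, norm_inv, Real.norm_of_nonneg hR0.le, inv_mul_le_one₀ hR0]
      exact (hR x hx).trans (le_max_left _ _)
    · simp [image_eq_zero_of_notMem_tsupport hx]
  rw [e, mul_comm]
  refine (hk.enorm_apply_le (hu θR) φ.toSchwartz).trans ?_
  gcongr
  refine (hD _ (hu θR)).2.trans ?_
  rw [hM]
  gcongr
  refine (h.katoNorm_smulDistr_le hk hC χ θR hu).trans ?_
  gcongr
  exact multiplierConst_dilateTest_le hR1 C N θ

/-- A linear functional bounded by the norm of a linear map into a Hilbert space is represented by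
a vector of this space. -/
theorem exists_inner_eq_of_norm_le {V H : Type*} [AddCommGroup V] [Module ℂ V]
    [NormedAddCommGroup H] [InnerProductSpace ℂ H] [CompleteSpace H] (J : V →ₗ[ℂ] H)
    (l : V →ₗ[ℂ] ℂ) (M : ℝ) (h : ∀ v, ‖l v‖ ≤ M * ‖J v‖) :
    ∃ g : H, ∀ v, l v = inner ℂ g (J v) := by
  -- The bound makes `l` factor through the range of `J`, where it is continuous; it then extends by
  -- Hahn-Banach and is represented by Riesz.
  have hker : J.ker ≤ l.ker := by
    intro v hv
    rw [LinearMap.mem_ker] at hv ⊢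
    have := h v
    rw [hv, norm_zero, mul_zero] at this
    exact norm_le_zero_iff.1 this
  let l' : J.range →ₗ[ℂ] ℂ := (J.ker.liftQ l hker) ∘ₗ J.quotKerEquivRange.symm.toLinearMap
  have hl' : ∀ v, l' ⟨J v, LinearMap.mem_range_self J v⟩ = l v := fun v => by
    have : J.quotKerEquivRange.symm ⟨J v, LinearMap.mem_range_self J v⟩ = J.ker.mkQ v := by
      rw [LinearEquiv.symm_apply_eq]
      rfl
    change J.ker.liftQ l hker (J.quotKerEquivRange.symm _) = _
    rw [this]
    rfl
  let L : J.range →L[ℂ] ℂ := l'.mkContinuous M (by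
    rintro ⟨-, v, rfl⟩
    rw [hl']
    exact h v)
  obtain ⟨G, hG, -⟩ := exists_extension_norm_eq J.range L
  refine ⟨(InnerProductSpace.toDual ℂ H).symm G, fun v => ?_⟩
  rw [InnerProductSpace.toDual_symm_apply, ← hl' v]
  exact (hG ⟨J v, LinearMap.mem_range_self J v⟩).symm

theorem IsWeight.exists_representing (hk : IsWeight k) {u : Distr n} {M : ℝ≥0}
    (h : ∀ φ : Test n,
      ‖u φ‖ₑ ≤ M * eLpNorm (fun ξ => hatInv n φ.toSchwartz ξ / (k ξ : ℂ)) 2 volume) :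
    ∃ f : Rn n → ℂ, MemLp (fun ξ => (k ξ : ℂ) * f ξ) 2 ∧
      ∀ φ : Test n, u φ = ∫ ξ, hatInv n φ.toSchwartz ξ * f ξ := by
  have hmem : ∀ φ : Test n, MemLp (fun ξ => hatInv n φ.toSchwartz ξ / (k ξ : ℂ)) 2 :=
    fun φ => hk.memLp_schwartz_div _ 2
  let J : Test n →ₗ[ℂ] Lp ℂ 2 (volume : Measure (Rn n)) :=
    { toFun := fun φ => (hmem φ).toLp
      map_add' := fun φ ψ => by
        rw [← MemLp.toLp_add]
        congr 1
        ext ξ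
        change hatInv n (testToSchwartz n (φ + ψ)) ξ / _ = hatInv n (testToSchwartz n φ) ξ / _ +
          hatInv n (testToSchwartz n ψ) ξ / _
        rw [map_add, map_add, add_apply, add_div]
      map_smul' := fun c φ => by
        rw [RingHom.id_apply, ← MemLp.toLp_const_smul]
        congr 1
        ext ξ
        change hatInv n (testToSchwartz n (c • φ)) ξ / _ =
          c * (hatInv n (testToSchwartz n φ) ξ / _)
        rw [map_smul, map_smul, smul_apply, smul_eq_mul, mul_div_assoc] }
  obtain ⟨g, hg⟩ := exists_inner_eq_of_norm_le J (u : Test n →ₗ[ℂ] ℂ) M (fun φ => by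
    have h1 := ENNReal.toReal_mono (ENNReal.mul_ne_top ENNReal.coe_ne_top (hmem φ).2.ne) (h φ)
    rw [toReal_enorm, ENNReal.toReal_mul, ENNReal.coe_toReal] at h1
    change ‖u φ‖ ≤ M * ‖(hmem φ).toLp‖
    rwa [Lp.norm_toLp])
  -- The inner product conjugates `g`, and `J φ` carries a factor `k⁻¹`; both are moved into `f`, so
  -- that `k f = conj g` is in `L²`.
  refine ⟨fun ξ => (starRingEnd ℂ) (g ξ) / (k ξ : ℂ), ?_, fun φ => ?_⟩
  · refine (Lp.memLp g).star.ae_eq (.of_forall fun ξ => ?_)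
    simp only [Pi.star_apply]
    rw [mul_div_cancel₀ _ (hk.ofReal_ne_zero ξ)]
    rfl
  · refine (hg φ).trans ?_
    rw [L2.inner_def]
    refine integral_congr_ae ?_
    filter_upwards [(hmem φ).coeFn_toLp] with ξ hξ
    change inner ℂ (g ξ) ((hmem φ).toLp _ ξ) = _
    rw [hξ, RCLike.inner_apply]
    ring

/-- The `L²` function `f / ⟨·⟩ ^ N` is a tempered distribution; multiplying test functions by `⟨·⟩ ^
N` restores `f`, and `hatInv` undoes the transform. -/
theorem IsWeight.exists_hatDistr_eq (hk : IsWeight k) {f : Rn n → ℂ}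
    (hf : MemLp (fun ξ => (k ξ : ℂ) * f ξ) 2) :
    ∃ T : 𝓢'(Rn n, ℂ), ∀ φ, hatDistr T φ = ∫ ξ, φ ξ * f ξ := by
  obtain ⟨C, N, -, h⟩ := hk.exists_growthBound
  have hb := h.memLp_div_bracket hk hf
  refine ⟨PointwiseConvergenceCLM.precomp ℂ (bracketMul N ∘L hatInv n)
    (Lp.toTemperedDistribution hb.toLp), fun φ => ?_⟩
  change Lp.toTemperedDistribution hb.toLp (bracketMul N (hatInv n (hat n φ))) = _
  rw [hatInv_hat, Lp.toTemperedDistribution_apply]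
  refine integral_congr_ae ?_
  filter_upwards [hb.coeFn_toLp] with ξ hξ
  have : (bracket N ξ : ℂ) ≠ 0 := Complex.ofReal_ne_zero.2 (bracket_pos N ξ).ne'
  rw [hξ, bracketMul_apply, smul_eq_mul]
  field_simp

theorem IsWeight.mem_image_restrict (hk : IsWeight k) {χ : Test n} (hχ : χ ≠ 0) {u : Distr n}
    (hu : u ∈ hormanderLoc k) (hu' : katoNorm k 2 χ u < ⊤) :
    u ∈ restrict '' hormanderSpace k := by
  obtain ⟨M, hM⟩ := hk.exists_enorm_apply_le hχ hu hu'
  obtain ⟨f, hf, huf⟩ := hk.exists_representing hM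
  obtain ⟨T, hT⟩ := hk.exists_hatDistr_eq hf
  refine ⟨T, ⟨f, hk.isFunction hf hT, hf⟩, ?_⟩
  ext φ
  rw [restrict_apply, huf, ← hT, hatDistr_apply, hat_hatInv]

theorem IsWeight.katoSpace_subset (hk : IsWeight k) :
    katoSpace k 2 ⊆ restrict '' hormanderSpace k := by
  rintro u ⟨χ, hχ, hu, hu'⟩
  exact hk.mem_image_restrict hχ (hk.mem_hormanderLoc hχ hu) hu'.2

theorem IsWeight.image_restrict_subset_wienerAmalgam (hk : IsWeight k) {χ : Test n}
    (hχ : χ ≠ 0) : restrict '' hormanderSpace k ⊆ wienerAmalgam k 2 χ := by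
  rintro - ⟨T, hT, rfl⟩
  exact ⟨fun φ => hk.smulDistr_mem φ hT, hk.memLp_control hχ hT⟩

theorem wienerAmalgam_subset_katoSpace {χ : Test n} (hχ : χ ≠ 0) :
    wienerAmalgam k 2 χ ⊆ katoSpace k 2 :=
  fun _ hu => ⟨χ, hχ, fun y => hu.1 (translate y χ), hu.2⟩

end Kato

end

theorem mainTheorem5 (n : ℕ) (k : Kato.Rn n → ℝ) (hk : Kato.IsWeight k) :
    Kato.restrict '' Kato.hormanderSpace k = Kato.katoSpace k 2 ∧
    (∀ χ : Kato.Test n, χ ≠ 0 → Kato.katoSpace k 2 = Kato.wienerAmalgam k 2 χ) ∧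
    (∀ χ : Kato.Test n, χ ≠ 0 → ∃ C : ℝ≥0, 0 < C ∧
      ∀ T ∈ Kato.hormanderSpace k,
        Kato.katoNorm k 2 χ (Kato.restrict T) ≤ C * Kato.hormanderNorm k T ∧
        Kato.hormanderNorm k T ≤ C * Kato.katoNorm k 2 χ (Kato.restrict T)) := by
  refine ⟨?_, fun χ hχ => ?_, fun χ hχ => hk.exists_norm_equiv hχ⟩
  -- The first equality mentions no window, so one nonzero test function is needed to pass through
  -- the amalgam space.
  · obtain ⟨θ, hθ⟩ := Kato.exists_test_ne_zero n
    exact (hk.image_restrict_subset_wienerAmalgam hθ).trans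
      (Kato.wienerAmalgam_subset_katoSpace hθ) |>.antisymm hk.katoSpace_subset
  · exact (hk.katoSpace_subset.trans (hk.image_restrict_subset_wienerAmalgam hχ)).antisymm
      (Kato.wienerAmalgam_subset_katoSpace hχ)
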